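/- **Setting.** Let $d\in\{2,3\}$ and let $\Omega_h$ be a finite conforming simplicial mesh either of a bounded polyhedral domain $\Omega\subset\mathbb R^d$ (no-slip case) or of the torus $\Omega=\mathbb R^d/\mathbb Z^d$ (periodic case); $h$ is the maximal diameter of its cells. Every interior face $\sigma=K|L\in\mathcal E^I$ carries a unit normal $\mathbf n_\sigma$ pointing from $K$ to $L$; $f^{\rm in}$, $f^{\rm out}$ are the traces from $K$ and $L$, $[\![f]\!]=f^{\rm out}-f^{\rm in}$, $\{f\}=\frac12(f^{\rm in}+f^{\rm out})$. Exterior faces (absent in the periodic case) are those of a single cell. $\nabla_h,\mathrm{div}_h,\mathbf{curl}_h$ act cell by cell. Cross products and curls are those of $\mathbb R^3$; for $d=2$ they are the planar reduction ($\mathbf u,\mathbf B$ planar, $\mathbf E,\mathbf j$ directed along the third axis, nothing depends on the third variable). *Spaces.* $Q_h$: piecewise constants. $V_{0,h}$: piecewise affine $\mathbf v$ with values in $\mathbb R^d$, $\int_\sigma[\![\mathbf v]\!]=0$ on interior faces and $\int_\sigma\mathbf v=0$ on exterior faces (Crouzeix–Raviart). $\mathcal R_{0,h}$: fields equal to $\mathbf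 a_K+b_K\mathbf x$ on each cell ($\mathbf a_K\in\mathbb R^d,b_K\in\mathbb R$), with $\mathbf v\cdot\mathbf n$ continuous across interior faces and $\int_\sigma\mathbf v\cdot\mathbf n=0$ on exterior faces (Raviart–Thomas). $\mathcal N_{0,h}$: fields equal to $\mathbf a_K+\mathbf b_K\times\mathbf x$ on each cell ($\mathbf a_K,\mathbf b_K\in\mathbb R^3$; for $d=2$ with values along the third axis), with $\mathbf v\times\mathbf n$ continuous across interior faces and $\int_\sigma\mathbf v\times\mathbf n=0$ on exterior faces (Nédélec). $\widehat{v}=\Pi_Qv$ is the cellwise mean. *Parameters.* $\mu>0$, $\nu:=\frac{d-2}{d}\mu+\lambda\ge0$, $a>0$, $\gamma>1$, $\varepsilon>-1$, $p(\varrho)=a\varrho^\gamma$, $\mathcal H(\varrho)=\frac{a}{\gamma-1}\varrho^\gamma$, $p_h=p(\varrho_h)$, $\Delta t>0$, $T=N\Delta t$ with $N\in\mathbb N$. Discrete functions of time are constant for $t\le0$ and on each $((k-1)\Delta t,k\Delta t]$, $1\le k\le N$; $v^{\triangleleft}(t)=v(t-\Delta t)$, $D_tv=(v-v^\triangleleft)/\Delta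 t$. *Fluxes.* $u_\sigma=\frac1{|\sigma|}\int_\sigma\mathbf u_h\cdot\mathbf n_\sigma$; $r^{\rm up}=r^{\rm in}$ if $u_\sigma\ge0$ and $r^{\rm up}=r^{\rm out}$ otherwise; $F_h^\varepsilon(r,\mathbf u_h)=r^{\rm up}u_\sigma-h^\varepsilon[\![r]\!]$. **Scheme-I.** $(\varrho_h,\mathbf u_h,\mathbf B_h,\mathbf E_h)$, with values in $Q_h\times V_{0,h}\times\mathcal R_{0,h}\times\mathcal N_{0,h}$, is a solution if, with $\mathbf j_h=\mathbf E_h+\mathbf u_h\times\mathbf B_h^\triangleleft$, for every $t\in(0,T]$ $$\int_\Omega D_t\varrho_h\,\phi_h-\sum_{\sigma\in\mathcal E^I}\int_\sigma F_h^\varepsilon(\varrho_h,\mathbf u_h)[\![\phi_h]\!]=0\quad\forall\phi_h\in Q_h,$$ $$\int_\Omega D_t(\varrho_h\widehat{\mathbf u_h})\cdot\mathbf v_h-\sum_{\sigma\in\mathcal E^I}\int_\sigma F_h^\varepsilon(\varrho_h\widehat{\mathbf u_h},\mathbf u_h)\cdot[\![\widehat{\mathbf v_h}]\!]+\mu\int_\Omega\nabla_h\mathbf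 u_h:\nabla_h\mathbf v_h+\int_\Omega(\nu\,\mathrm{div}_h\mathbf u_h-p_h)\mathrm{div}_h\mathbf v_h-\int_\Omega(\mathbf j_h\times\mathbf B_h^\triangleleft)\cdot\mathbf v_h=0\quad\forall\mathbf v_h\in V_{0,h},$$ $$\int_\Omega\big(D_t\mathbf B_h\cdot\mathbf C_h+\mathbf{curl}_h\mathbf E_h\cdot\mathbf C_h\big)=0\quad\forall\mathbf C_h\in\mathcal R_{0,h},\qquad\int_\Omega\big(\mathbf j_h\cdot\boldsymbol\psi_h-\mathbf B_h\cdot\mathbf{curl}_h\boldsymbol\psi_h\big)=0\quad\forall\boldsymbol\psi_h\in\mathcal N_{0,h}.$$ The discrete initial data $(\varrho_h,\mathbf u_h,\mathbf B_h)(0)$ may be arbitrary elements of $Q_h\times V_{0,h}\times\mathcal R_{0,h}$ with $\varrho_h(0)>0$ (in particular interpolants of initial data with $\varrho_0>0$). **Theorem (Stability of Scheme-I).** Let $(\varrho_h,\mathbf u_h,\mathbf B_h,\mathbf E_h)$ be a solution of Scheme-I with $\gamma>1$ and $\varrho_h(0)>0$. Then for every $t\in(0,T]$ we have $\varrho_h(t)>0$,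 and there exist a piecewise constant $\xi$ with $\xi|_K$ between $\varrho_h^\triangleleft|_K$ and $\varrho_h|_K$ for every cell $K$, and numbers $\zeta=\zeta_\sigma$ between $\varrho_h^{\rm in}$ and $\varrho_h^{\rm out}$ for every $\sigma\in\mathcal E^I$, such that $$\begin{aligned}D_t&\int_\Omega\Big(\tfrac12\varrho_h|\widehat{\mathbf u_h}|^2+\mathcal H(\varrho_h)+\tfrac12|\mathbf B_h|^2\Big)+\mu\|\nabla_h\mathbf u_h\|_{L^2}^2+\nu\|\mathrm{div}_h\mathbf u_h\|_{L^2}^2+\|\mathbf j_h\|_{L^2}^2\\=&-\frac{\Delta t}2\int_\Omega\varrho_h^\triangleleft|D_t\widehat{\mathbf u_h}|^2-\frac{\Delta t}2\int_\Omega|D_t\mathbf B_h|^2-\frac{\Delta t}2\int_\Omega\mathcal H''(\xi)|D_t\varrho_h|^2\\&-\sum_{\sigma\in\mathcal E^I}\int_\sigma\Big(\varrho_h^{\rm up}\frac{|u_\sigma|}2+h^\varepsilon\{\varrho_h\}\Big)\big|[\![\widehat{\mathbf u_h}]\!]\big|^2-\sum_{\sigma\in\mathcal E^I}\int_\sigma\mathcal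 H''(\zeta)[\![\varrho_h]\!]^2\Big(h^\varepsilon+\frac{|u_\sigma|}2\Big)\le0.\end{aligned}$$ Consequently the total energy $t\mapsto\int_\Omega\big(\frac12\varrho_h|\widehat{\mathbf u_h}|^2+\mathcal H(\varrho_h)+\frac12|\mathbf B_h|^2\big)$ is non-increasing on $[0,T]$. -/

import Mathlib

open MeasureTheory Set
open scoped MeasureTheory

noncomputable section

namespace MHD

/-- The Euclidean space `ℝᵈ`. -/
abbrev Vec (d : ℕ) : Type := EuclideanSpace ℝ (Fin d)

/-! ### Vector calculus

Magnetic and velocity fields take values in `ℝᵈ`. Cross products and curls are those of `ℝ³`; for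
`d = 2` they are the planar reduction (all fields independent of the third variable), in which
`u, B` are planar and `E, j` point in the third direction. -/

/-- The embedding `ℝᵈ → ℝ³`, `x ↦ (x, 0)` (the identity for `d = 3`). -/
def emb {d : ℕ} (x : Vec d) : Vec 3 :=
  WithLp.toLp 2 fun i => if h : i.val < d then x ⟨i.val, h⟩ else 0

/-- The cross product of `ℝ³`. -/
def cross (a b : Vec 3) : Vec 3 := WithLp.toLp 2 (crossProduct a.ofLp b.ofLp)

/-- The values of electric fields and currents: `ℝ³` if `d = 3`, the third axis if `d = 2`. -/
def IsElectric (d : ℕ) (v : Vec 3) : Prop := d = 2 → v 0 = 0 ∧ v 1 = 0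

/-- `partialD k f x = ∂ₖ f (x)`, which is `0` for a variable that is not present. -/
def partialD {d : ℕ} (k : Fin 3) (f : Vec d → Vec 3) (x : Vec d) : Vec 3 :=
  if h : k.val < d then fderiv ℝ f x (EuclideanSpace.single ⟨k.val, h⟩ 1) else 0

/-- The curl. -/
def curl {d : ℕ} (f : Vec d → Vec 3) (x : Vec d) : Vec 3 :=
  !₂[partialD 1 f x 2 - partialD 2 f x 1,
     partialD 2 f x 0 - partialD 0 f x 2,
     partialD 0 f x 1 - partialD 1 f x 0]

/-- The divergence. -/
def divg {d : ℕ} (v : Vec d → Vec d) (x : Vec d) : ℝ :=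
  ∑ i : Fin d, fderiv ℝ v x (EuclideanSpace.single i 1) i

/-- The Frobenius product `∇v : ∇w`. -/
def gradInner {d : ℕ} (v w : Vec d → Vec d) (x : Vec d) : ℝ :=
  ∑ i : Fin d, ∑ j : Fin d,
    fderiv ℝ v x (EuclideanSpace.single j 1) i * fderiv ℝ w x (EuclideanSpace.single j 1) i

/-! ### Meshes -/

/-- The closed simplex spanned by `s`. -/
def hull {d : ℕ} (s : Affine.Simplex ℝ (Vec d) d) : Set (Vec d) :=
  convexHull ℝ (range s.points)

/-- The vertices of the face of `s` opposite to its `i`-th vertex. -/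
def facetVertices {d : ℕ} (s : Affine.Simplex ℝ (Vec d) d) (i : Fin (d + 1)) : Set (Vec d) :=
  s.points '' {i}ᶜ

/-- The (closed, `(d-1)`-dimensional) face of `s` opposite to its `i`-th vertex. -/
def facet {d : ℕ} (s : Affine.Simplex ℝ (Vec d) d) (i : Fin (d + 1)) : Set (Vec d) :=
  convexHull ℝ (facetVertices s i)

/-- A finite conforming simplicial mesh in `ℝᵈ`, possibly modulo a group of periods. In the
periodic case `Cell` lists one representative of every class of cells modulo the periods.
A face of a cell is given by the cell and the index of the opposite vertex. Every interior face
`σ = K|L` carries a fixed orientation: `inn σ` is `σ` as a face of `K`, `out σ` is `σ` as a face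
of `L` (up to translation by the period `shift σ`), and the unit normal `n_σ` points from `K`
to `L`. -/
structure Mesh (d : ℕ) where
  /-- the cells -/
  Cell : Type
  /-- the interior faces -/
  IFace : Type
  [fintypeCell : Fintype Cell]
  [fintypeIFace : Fintype IFace]
  /-- the (nondegenerate) simplex of a cell -/
  simplex : Cell → Affine.Simplex ℝ (Vec d) d
  /-- the group of periods (trivial for a mesh of a bounded domain) -/
  period : AddSubgroup (Vec d)
  /-- different cells (modulo periods) have different vertex sets -/
  cell_inj : ∀ K L, ∀ p ∈ period,
    range (simplex K).points = (fun x => p + x) '' range (simplex L).points → K = L ∧ p = 0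
  /-- two cells intersect exactly in the common face spanned by their common vertices -/
  conforming : ∀ K L, ∀ p ∈ period,
    hull (simplex K) ∩ (fun x => p + x) '' hull (simplex L) =
      convexHull ℝ (range (simplex K).points ∩ (fun x => p + x) '' range (simplex L).points)
  /-- an interior face as a face of the cell on its inner side -/
  inn : IFace → Cell × Fin (d + 1)
  /-- an interior face as a face of the cell on its outer side -/
  out : IFace → Cell × Fin (d + 1)
  /-- the period that moves the outer cell next to the inner one -/
  shift : IFace → Vec d
  shift_mem : ∀ σ, shift σ ∈ period
  /-- the two descriptions of an interior face agree -/
  face_match : ∀ σ, facetVertices (simplex (inn σ).1) (inn σ).2 =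
    (fun x => shift σ + x) '' facetVertices (simplex (out σ).1) (out σ).2
  /-- every face of a cell belongs to at most one interior face, on one of its sides -/
  face_inj : Function.Injective (Sum.elim inn out)
  /-- whenever two different cells share a face, it is listed as an interior face -/
  face_complete : ∀ (K L : Cell) (i j : Fin (d + 1)), ∀ p ∈ period, (K, i) ≠ (L, j) →
    facetVertices (simplex K) i = (fun x => p + x) '' facetVertices (simplex L) j →
    ∃ σ, (inn σ = (K, i) ∧ out σ = (L, j)) ∨ (inn σ = (L, j) ∧ out σ = (K, i))
  /-- `normal K i` is the unit normal, outward to `K`, on the face of `K` opposite to vertex `i` -/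
  normal : Cell → Fin (d + 1) → Vec d
  normal_unit : ∀ K i, ‖normal K i‖ = 1
  normal_orth : ∀ K i, ∀ j k, j ≠ i → k ≠ i →
    inner ℝ (normal K i) ((simplex K).points j - (simplex K).points k) = 0
  normal_outward : ∀ K i, ∀ j, j ≠ i →
    inner ℝ (normal K i) ((simplex K).points i - (simplex K).points j) < 0
  /-- the two cells of an interior face lie on opposite sides of it -/
  normal_opposite : ∀ σ, normal (out σ).1 (out σ).2 = -normal (inn σ).1 (inn σ).2

attribute [instance] Mesh.fintypeCell Mesh.fintypeIFace

/-- `M` is a triangulation of the bounded (polyhedral) domain `Ω`. -/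
def Mesh.Triangulates {d : ℕ} (M : Mesh d) (Ω : Set (Vec d)) : Prop :=
  M.period = ⊥ ∧ IsConnected Ω ∧ Ω = interior (⋃ K, hull (M.simplex K))

/-- `M` is a triangulation of the torus `ℝᵈ / ℤᵈ`. -/
def Mesh.TriangulatesTorus {d : ℕ} (M : Mesh d) : Prop :=
  (∀ x : Vec d, x ∈ M.period ↔ ∀ i, ∃ n : ℤ, x i = n) ∧
  (⋃ p ∈ M.period, ⋃ K, (fun x => p + x) '' hull (M.simplex K)) = univ

namespace Mesh

variable {d : ℕ} (M : Mesh d)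

/-- Piecewise smooth functions on the mesh; `v K` is the function on the cell `K`. -/
abbrev Broken (F : Type) : Type := M.Cell → Vec d → F

/-- The mesh size `h`, the maximal diameter of the cells. -/
def meshSize : ℝ := ⨆ K, Metric.diam (hull (M.simplex K))

/-- The exterior faces: those which are not interior. -/
def IsExterior (K : M.Cell) (i : Fin (d + 1)) : Prop :=
  ∀ σ, M.inn σ ≠ (K, i) ∧ M.out σ ≠ (K, i)

/-- `∫_Ω f`. -/
def integral (f : M.Broken ℝ) : ℝ := ∑ K, ∫ x in hull (M.simplex K), f K x

/-- The surface integral over a face of a cell. -/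
def facetIntegral {F : Type} [NormedAddCommGroup F] [NormedSpace ℝ F]
    (K : M.Cell) (i : Fin (d + 1)) (f : Vec d → F) : F :=
  ∫ x in facet (M.simplex K) i, f x ∂(μHE[d - 1])

/-- The surface integral `∫_σ f` over an interior face. -/
def faceIntegral {F : Type} [NormedAddCommGroup F] [NormedSpace ℝ F]
    (σ : M.IFace) (f : Vec d → F) : F :=
  M.facetIntegral (M.inn σ).1 (M.inn σ).2 f

/-- The area `|σ|`. -/
def area (σ : M.IFace) : ℝ :=
  (μHE[d - 1] : Measure (Vec d)).real (facet (M.simplex (M.inn σ).1) (M.inn σ).2)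

/-- The normal `n_σ`. -/
def nrm (σ : M.IFace) : Vec d := M.normal (M.inn σ).1 (M.inn σ).2

/-- The trace `v^in` on `σ`. -/
def traceIn {F : Type} (v : M.Broken F) (σ : M.IFace) (x : Vec d) : F := v (M.inn σ).1 x

/-- The trace `v^out` on `σ`. -/
def traceOut {F : Type} (v : M.Broken F) (σ : M.IFace) (x : Vec d) : F :=
  v (M.out σ).1 (x - M.shift σ)

/-- The jump `v^out - v^in` on `σ`. -/
def jump {F : Type} [AddCommGroup F] (v : M.Broken F) (σ : M.IFace) (x : Vec d) : F :=
  M.traceOut v σ x - M.traceIn v σ x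

/-! ### Finite element spaces

The space `Q_h` of piecewise constants is `M.Cell → F`. -/

/-- The jump of a piecewise constant function. -/
def jumpC {F : Type} [AddCommGroup F] (r : M.Cell → F) (σ : M.IFace) : F :=
  r (M.out σ).1 - r (M.inn σ).1

/-- The average `{r}` of a piecewise constant function. -/
def avgC (r : M.Cell → ℝ) (σ : M.IFace) : ℝ := (r (M.out σ).1 + r (M.inn σ).1) / 2

/-- The elementwise mean `v̂ = Π_Q v`. -/
def hat {F : Type} [NormedAddCommGroup F] [NormedSpace ℝ F] (v : M.Broken F) (K : M.Cell) : F :=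
  ⨍ x in hull (M.simplex K), v K x

/-- The Crouzeix–Raviart space with vanishing face means on the boundary. -/
def CR₀ : Set (M.Broken (Vec d)) :=
  {v | (∀ K, ∃ A : Vec d →ᵃ[ℝ] Vec d, ∀ x, v K x = A x) ∧
    (∀ σ, M.faceIntegral σ (M.jump v σ) = 0) ∧
    (∀ K i, M.IsExterior K i → M.facetIntegral K i (v K) = 0)}

/-- The lowest order Raviart–Thomas space with vanishing normal component on the boundary.
The continuity of the normal component across interior faces expresses `div v ∈ L²(Ω)`. -/
def RT₀ : Set (M.Broken (Vec d)) :=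
  {v | (∀ K, ∃ (a : Vec d) (b : ℝ), ∀ x, v K x = a + b • x) ∧
    (∀ σ, ∀ x ∈ facet (M.simplex (M.inn σ).1) (M.inn σ).2,
      inner ℝ (M.jump v σ x) (M.nrm σ) = 0) ∧
    (∀ K i, M.IsExterior K i →
      M.facetIntegral K i (fun x => inner ℝ (v K x) (M.normal K i)) = 0)}

/-- The lowest order Nédélec space with vanishing mean tangential trace on boundary faces.
The continuity of the tangential trace across interior faces expresses `curl v ∈ L²(Ω)`.
For `d = 2` the elements are `(0, 0, w)` with `w` continuous and piecewise affine. -/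
def ND₀ : Set (M.Broken (Vec 3)) :=
  {v | (∀ K, ∃ a b : Vec 3, ∀ x, v K x = a + cross b (emb x)) ∧
    (∀ K x, IsElectric d (v K x)) ∧
    (∀ σ, ∀ x ∈ facet (M.simplex (M.inn σ).1) (M.inn σ).2,
      cross (M.jump v σ x) (emb (M.nrm σ)) = 0) ∧
    (∀ K i, M.IsExterior K i →
      M.facetIntegral K i (fun x => cross (v K x) (emb (M.normal K i))) = 0)}

/-! ### Numerical fluxes -/

/-- `u_σ = |σ|⁻¹ ∫_σ u · n_σ`. -/
def normalVel (u : M.Broken (Vec d)) (σ : M.IFace) : ℝ :=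
  (M.area σ)⁻¹ * M.faceIntegral σ (fun x => inner ℝ (M.traceIn u σ x) (M.nrm σ))

/-- The upwind value `r^up`. -/
def upwind {F : Type} (r : M.Cell → F) (u : M.Broken (Vec d)) (σ : M.IFace) : F :=
  open Classical in if 0 ≤ M.normalVel u σ then r (M.inn σ).1 else r (M.out σ).1

/-- The diffusive upwind flux `F_h^ε(r, u) = r^up u_σ - h^ε ⟦r⟧`. -/
def flux {F : Type} [AddCommGroup F] [Module ℝ F] (ε : ℝ) (r : M.Cell → F)
    (u : M.Broken (Vec d)) (σ : M.IFace) : F :=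
  M.normalVel u σ • M.upwind r u σ - M.meshSize ^ ε • M.jumpC r σ

end Mesh

/-! ### The scheme -/

/-- The physical and numerical parameters: viscosities `μ`, `λ`, pressure law `p(ρ) = a ρ^γ`,
diffusion exponent `ε` of the flux, time step `τ = Δt`. -/
structure Params where
  μ : ℝ
  lam : ℝ
  a : ℝ
  γ : ℝ
  ε : ℝ
  τ : ℝ

/-- `ν = (d-2)/d μ + λ`. -/
def Params.ν (P : Params) (d : ℕ) : ℝ := ((d : ℝ) - 2) / d * P.μ + P.lam

/-- The pressure `p(ρ) = a ρ^γ`. -/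
def Params.p (P : Params) (r : ℝ) : ℝ := P.a * r ^ P.γ

/-- The pressure potential `H(ρ) = a/(γ-1) ρ^γ`. -/
def Params.H (P : Params) (r : ℝ) : ℝ := P.a / (P.γ - 1) * r ^ P.γ

/-- The second derivative `H''`. -/
def Params.H'' (P : Params) (r : ℝ) : ℝ := deriv (deriv P.H) r

/-- The backward Euler derivative `D_t f (t) = (f(t) - f(t - Δt)) / Δt`. -/
def Dt {X : Type} [AddCommGroup X] [Module ℝ X] (τ : ℝ) (f : ℝ → X) (t : ℝ) : X :=
  τ⁻¹ • (f t - f (t - τ))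

/-- `f` is constant on `(-∞, 0]` and on `((k-1)τ, kτ]`, `k = 1, …, N`, with values in `Y`. -/
def IsStep {X : Type} (τ : ℝ) (N : ℕ) (Y : Set X) (f : ℝ → X) : Prop :=
  (∀ t ≤ 0, f t = f 0) ∧
  (∀ k : ℕ, 1 ≤ k → k ≤ N → ∀ t ∈ Ioc (((k : ℝ) - 1) * τ) (k * τ), f t = f (k * τ)) ∧
  (∀ t ≤ N * τ, f t ∈ Y)

/-- The current density `j_h = E_h + u_h × B_h(· - Δt)`. -/
def current {d : ℕ} {M : Mesh d} (P : Params) (u B : ℝ → M.Broken (Vec d))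
    (E : ℝ → M.Broken (Vec 3)) (t : ℝ) : M.Broken (Vec 3) :=
  fun K x => E t K x + cross (emb (u t K x)) (emb (B (t - P.τ) K x))

/-- `(ρ, u, B, E)` is a solution of the mixed finite volume – finite element scheme on `[0, T]`,
`T = N Δt`. -/
structure IsSolution {d : ℕ} (M : Mesh d) (P : Params) (N : ℕ) (ρ : ℝ → M.Cell → ℝ)
    (u B : ℝ → M.Broken (Vec d)) (E : ℝ → M.Broken (Vec 3)) : Prop where
  ρ_step : IsStep P.τ N univ ρ
  u_step : IsStep P.τ N M.CR₀ u
  B_step : IsStep P.τ N M.RT₀ B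
  E_step : IsStep P.τ N M.ND₀ E
  /-- the continuity equation -/
  continuity : ∀ t ∈ Ioc 0 (N * P.τ), ∀ φ : M.Cell → ℝ,
    M.integral (fun K _ => Dt P.τ ρ t K * φ K) -
      ∑ σ, M.faceIntegral σ (fun _ => M.flux P.ε (ρ t) (u t) σ * M.jumpC φ σ) = 0
  /-- the momentum equation -/
  momentum : ∀ t ∈ Ioc 0 (N * P.τ), ∀ v ∈ M.CR₀,
    M.integral (fun K x => inner ℝ (Dt P.τ (fun s K => ρ s K • M.hat (u s) K) t K) (v K x)) -
      ∑ σ, M.faceIntegral σ (fun _ =>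
        inner ℝ (M.flux P.ε (fun K => ρ t K • M.hat (u t) K) (u t) σ) (M.jumpC (M.hat v) σ)) +
      P.μ * M.integral (fun K x => gradInner (u t K) (v K) x) +
      M.integral (fun K x => (P.ν d * divg (u t K) x - P.p (ρ t K)) * divg (v K) x) -
      M.integral (fun K x =>
        inner ℝ (cross (current P u B E t K x) (emb (B (t - P.τ) K x))) (emb (v K x))) = 0
  /-- Faraday's law -/
  faraday : ∀ t ∈ Ioc 0 (N * P.τ), ∀ C ∈ M.RT₀,
    M.integral (fun K x => inner ℝ (Dt P.τ B t K x) (C K x) +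
      inner ℝ (curl (E t K) x) (emb (C K x))) = 0
  /-- Ampère's law -/
  ampere : ∀ t ∈ Ioc 0 (N * P.τ), ∀ ψ ∈ M.ND₀,
    M.integral (fun K x => inner ℝ (current P u B E t K x) (ψ K x) -
      inner ℝ (emb (B t K x)) (curl (ψ K) x)) = 0

/-- The total energy `∫ ½ ρ |û|² + H(ρ) + ½ |B|²` at time `t`. -/
def energy {d : ℕ} (M : Mesh d) (P : Params) (ρ : ℝ → M.Cell → ℝ)
    (u B : ℝ → M.Broken (Vec d)) (t : ℝ) : ℝ :=
  M.integral (fun K x =>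
    1 / 2 * ρ t K * ‖M.hat (u t) K‖ ^ 2 + P.H (ρ t K) + 1 / 2 * ‖B t K x‖ ^ 2)

/-- The viscous and current dissipation `μ ‖∇_h u‖² + ν ‖div_h u‖² + ‖j‖²` at time `t`. -/
def dissipation {d : ℕ} (M : Mesh d) (P : Params)
    (u B : ℝ → M.Broken (Vec d)) (E : ℝ → M.Broken (Vec 3)) (t : ℝ) : ℝ :=
  P.μ * M.integral (fun K x => gradInner (u t K) (u t K) x) +
  P.ν d * M.integral (fun K x => divg (u t K) x ^ 2) +
  M.integral (fun K x => ‖current P u B E t K x‖ ^ 2)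

/-- The right-hand side of the energy balance at time `t`: minus the sum of the five numerical
dissipation terms. -/
def numericalTerms {d : ℕ} (M : Mesh d) (P : Params) (ρ : ℝ → M.Cell → ℝ)
    (u B : ℝ → M.Broken (Vec d)) (ξ : M.Cell → ℝ) (ζ : M.IFace → ℝ) (t : ℝ) : ℝ :=
  - (P.τ / 2 * M.integral (fun K _ =>
      ρ (t - P.τ) K * ‖Dt P.τ (fun s => M.hat (u s)) t K‖ ^ 2))
  - P.τ / 2 * M.integral (fun K x => ‖Dt P.τ B t K x‖ ^ 2)
  - P.τ / 2 * M.integral (fun K _ => P.H'' (ξ K) * |Dt P.τ ρ t K| ^ 2)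
  - ∑ σ, M.faceIntegral σ (fun _ =>
      (M.upwind (ρ t) (u t) σ * (|M.normalVel (u t) σ| / 2) +
        M.meshSize ^ P.ε * M.avgC (ρ t) σ) * ‖M.jumpC (M.hat (u t)) σ‖ ^ 2)
  - ∑ σ, M.faceIntegral σ (fun _ =>
      P.H'' (ζ σ) * M.jumpC (ρ t) σ ^ 2 *
        (M.meshSize ^ P.ε + |M.normalVel (u t) σ| / 2))

end MHD

end

/-! The balance comes from testing every equation with the dual variable of the energy: momentum
with `u`, continuity with `H'(ρ)` (added) and with `½|û|²` (subtracted), Faraday's law with `B`,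
Ampère's law with `E`. The two curl terms cancel. The work of the Lorentz force cancels too, because
the current and the force contain the same lagged field `B (t - τ)`. What is left decouples into
identities on single cells and single faces.

On a cell, backward Euler turns each product into a difference of energies plus a square
(`kinetic_cell_identity`, `magnetic_identity`) or a Taylor remainder of `H` (`exists_taylor_H`). On
a face, upwinding and artificial diffusion leave a multiple of the squared jump of `û`
(`kinetic_face_identity`). For the pressure, `integral_mul_divg` rewrites `-∫ p div u` as a sum of
`|σ| u_σ ⟦p⟧`: face means of Crouzeix–Raviart fields match across interior faces and vanish on
exterior ones. Through `p = ρ H' - H` this sum joins the mass flux tested with `H'(ρ)`, and the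
result is again a second order remainder (`exists_face_dissipation`).

The signs, and the use of `H` at all, require `ρ > 0`. This follows by testing the continuity
equation with the indicator of `{ρ ≤ 0}` (`Mesh.density_pos`) and induction over the time steps.

The divergence theorem is needed only for affine fields on a simplex. There it is linear algebra in
barycentric coordinates, once the integrals of affine functions over cells and faces and the cone
formula `d |K| = h |F|` are known. -/

namespace MHD

/-! ### Integrals of affine functions over a simplex. -/

section Simplex

variable {ι V W : Type*} [Fintype ι] [NormedAddCommGroup V] [NormedSpace ℝ V]

theorem affineMap_eq_sum_coord [AddCommGroup W] [Module ℝ W] (b : AffineBasis ι ℝ V)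
    (f : V →ᵃ[ℝ] W) (x : V) : f x = ∑ i, b.coord i x • f (b i) := by
  conv_lhs => rw [← b.affineCombination_coord_eq_self x,
    Finset.map_affineCombination _ _ _ (b.sum_coord_apply_eq_one x),
    Finset.affineCombination_eq_linear_combination _ _ _ (b.sum_coord_apply_eq_one x)]
  rfl

theorem isCompact_convexHull_range (p : ι → V) : IsCompact (convexHull ℝ (range p)) :=
  Set.Finite.isCompact_convexHull ℝ (finite_range p)

variable [FiniteDimensional ℝ V] [MeasurableSpace V] [BorelSpace V] (μ : Measure V) [μ.IsAddHaarMeasure]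

theorem setIntegral_affineMap_image (T : V →ᵃ[ℝ] V) (hT : Function.Injective T) {s : Set V}
    (hs : MeasurableSet s) (g : V → ℝ) :
    ∫ x in T '' s, g x ∂μ = |LinearMap.det T.linear| * ∫ x in s, g (T x) ∂μ := by
  rw [integral_image_eq_integral_abs_det_fderiv_smul μ hs
    (f' := fun _ => LinearMap.toContinuousLinearMap T.linear) _ hT.injOn]
  · simp [integral_const_mul, ContinuousLinearMap.det]
  · intro x _
    have h : (T : V → V) = fun y => LinearMap.toContinuousLinearMap T.linear y + T 0 := by
      ext1 y
      exact congrFun (AffineMap.decomp T) y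
    rw [h]
    exact ((LinearMap.toContinuousLinearMap T.linear).hasFDerivAt.add_const _).hasFDerivWithinAt

/-- Symmetry: the affine map exchanging the vertices `i` and `j` preserves the simplex, hence
volume, and exchanges the two barycentric coordinates. -/
theorem setIntegral_coord_eq (b : AffineBasis ι ℝ V) (i j : ι) :
    ∫ x in convexHull ℝ (range b), b.coord i x ∂μ =
      ∫ x in convexHull ℝ (range b), b.coord j x ∂μ := by
  classical
  set π := Equiv.swap i j
  set H := convexHull ℝ (range b)
  let T : V →ᵃ[ℝ] V := (Fintype.linearCombination ℝ (b ∘ π)).toAffineMap.comp b.coords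
  have hTx : ∀ x, T x = ∑ k, b.coord k x • b (π k) := fun x => by
    simp [T, Fintype.linearCombination_apply]
  have hTb : ∀ k, T (b k) = b (π k) := fun k => by simp [hTx, b.coord_apply]
  have hTT : ∀ x, T (T x) = x := fun x => by
    have := affineMap_eq_sum_coord b (T.comp T) x
    simp only [AffineMap.comp_apply, hTb, π, Equiv.swap_apply_self] at this
    rw [this, b.linear_combination_coord_eq_self]
  have hinj : Function.Injective T := (show Function.LeftInverse T T from hTT).injective
  have hTH : T '' H = H := by
    simp only [H]
    rw [T.image_convexHull, ← range_comp]
    congr 1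
    rw [show (T : V → V) ∘ b = b ∘ π from funext hTb, π.surjective.range_comp]
  have hcoord : ∀ x, b.coord i (T x) = b.coord j x := fun x => by
    have h1 := affineMap_eq_sum_coord b ((b.coord i).comp T) x
    have h2 := affineMap_eq_sum_coord b (b.coord j) x
    simp only [AffineMap.comp_apply, hTb] at h1
    rw [h1, h2]
    refine Finset.sum_congr rfl fun k _ => ?_
    congr 1
    simp only [b.coord_apply]
    refine if_congr ?_ rfl rfl
    rw [show i = π j from (Equiv.swap_apply_right i j).symm]
    simp
  have hm : MeasurableSet H := (isCompact_convexHull_range b).measurableSet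
  have h1 := setIntegral_affineMap_image μ T hinj hm (b.coord i)
  -- With integrand 1 the change of variables reads `|H| = |det T| |H|`, so `|det T| = 1` as soon as
  -- `|H| ≠ 0`.
  have h2 := setIntegral_affineMap_image μ T hinj hm (fun _ => 1)
  rw [hTH] at h1 h2
  simp only [hcoord] at h1
  simp only [setIntegral_const, smul_eq_mul, mul_one] at h2
  rcases eq_or_ne (μ.real H) 0 with h0 | h0
  · have : μ H = 0 := by
      rwa [measureReal_eq_zero_iff (isCompact_convexHull_range b).measure_lt_top.ne] at h0
    rw [setIntegral_measure_zero _ this, setIntegral_measure_zero _ this]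
  · rw [h1, show |LinearMap.det T.linear| = 1 from mul_right_cancel₀ h0 (by rw [one_mul, ← h2]),
      one_mul]

/-- The integral of an affine function over a simplex is the volume times the mean of the values
at the vertices. -/
theorem setIntegral_convexHull_affineMap (b : AffineBasis ι ℝ V) (f : V →ᵃ[ℝ] ℝ) :
    ∫ x in convexHull ℝ (range b), f x ∂μ =
      μ.real (convexHull ℝ (range b)) * ((∑ i, f (b i)) / Fintype.card ι) := by
  classical
  set H := convexHull ℝ (range b)
  have hc : IsCompact H := isCompact_convexHull_range b
  have hint : ∀ i, IntegrableOn (b.coord i) H μ := fun i =>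
    (b.coord i).continuous_of_finiteDimensional.continuousOn.integrableOn_compact hc
  obtain ⟨i₀⟩ := b.nonempty
  have hn : (Fintype.card ι : ℝ) ≠ 0 := by
    have : Nonempty ι := ⟨i₀⟩
    exact_mod_cast Fintype.card_ne_zero
  -- The coordinates sum to 1 and have equal integrals, so each integrates to `|H|` divided by the
  -- number of vertices.
  have h1 : μ.real H = Fintype.card ι * ∫ x in H, b.coord i₀ x ∂μ := by
    have : ∫ x in H, ∑ i, b.coord i x ∂μ = μ.real H := by
      simp [b.sum_coord_apply_eq_one]
    rw [← this, integral_finsetSum _ (fun i _ => hint i),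
      Finset.sum_congr rfl (fun i _ => setIntegral_coord_eq μ b i i₀), Finset.sum_const,
      nsmul_eq_mul, Finset.card_univ]
  have h2 : ∫ x in H, f x ∂μ = ∑ i, (∫ x in H, b.coord i x ∂μ) * f (b i) := by
    rw [← integral_congr_ae (.of_forall fun x => (affineMap_eq_sum_coord b f x).symm)]
    simp only [smul_eq_mul]
    rw [integral_finsetSum _ (fun i _ => (hint i).mul_const _)]
    simp [integral_mul_const]
  rw [h2, Finset.sum_congr rfl (fun i _ => by rw [setIntegral_coord_eq μ b i i₀]),
    ← Finset.mul_sum, h1]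
  rw [mul_div_assoc', mul_assoc, mul_div_cancel_left₀ _ hn]

end Simplex

/-! ### The same formula for lower-dimensional simplices and Hausdorff measure. -/

section Facet

variable {ι V : Type*} [Fintype ι] [NormedAddCommGroup V] [InnerProductSpace ℝ V]
  [MeasurableSpace V] [BorelSpace V]

/-- The convex hull of `m + 1` affinely independent points has finite `m`-dimensional measure, and
the integral of an affine function over it is its measure times the mean of the vertex values. -/
theorem setIntegral_euclideanHausdorffMeasure_convexHull {m : ℕ} {p : ι → V}
    (hp : AffineIndependent ℝ p) (hm : Fintype.card ι = m + 1) :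
    μHE[m] (convexHull ℝ (range p)) < ⊤ ∧ ∀ f : V →ᵃ[ℝ] ℝ,
      ∫ x in convexHull ℝ (range p), f x ∂μHE[m] =
        (μHE[m] : Measure V).real (convexHull ℝ (range p)) * ((∑ i, f (p i)) / (m + 1)) := by
  have hne : Nonempty ι := Fintype.card_pos_iff.1 (by omega)
  obtain ⟨i₀⟩ := hne
  let U := vectorSpan ℝ (range p)
  have hU : Module.finrank ℝ U = m := hp.finrank_vectorSpan hm
  -- An isometric parametrisation of the affine span by its direction space. There the simplex has
  -- full dimension and `μHE[m]` is a Haar measure, so the previous section applies.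
  let φ : U →ᵃ[ℝ] V := U.subtype.toAffineMap + AffineMap.const ℝ U (p i₀)
  have hφ : ∀ x, φ x = x + p i₀ := fun x => by simp [φ]
  have hiso : Isometry φ := by
    rw [show (φ : U → V) = (fun y => y + p i₀) ∘ ((↑) : U → V) from funext hφ]
    exact (IsometryEquiv.addRight (p i₀)).isometry.comp isometry_subtype_coe
  let q : ι → U := fun i => ⟨p i - p i₀, vsub_mem_vectorSpan ℝ (mem_range_self i) (mem_range_self i₀)⟩
  have hq : φ ∘ q = p := funext fun i => by simp [hφ, q]
  have hqi : AffineIndependent ℝ q := AffineIndependent.of_comp φ (by rwa [hq])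
  let b : AffineBasis ι ℝ U :=
    ⟨q, hqi, hqi.affineSpan_eq_top_iff_card_eq_finrank_add_one.2 (by rw [hU, hm])⟩
  have himg : φ '' convexHull ℝ (range b) = convexHull ℝ (range p) := by
    rw [φ.image_convexHull, ← range_comp]
    exact congrArg _ (congrArg _ hq)
  have hHaar : (μHE[m] : Measure U).IsAddHaarMeasure := by
    have := MeasureTheory.isAddHaarMeasure_euclideanHausdorffMeasure (E := U)
    rwa [hU] at this
  have hmeas : μHE[m] (convexHull ℝ (range p)) = μHE[m] (convexHull ℝ (range b)) := by
    rw [← himg, hiso.euclideanHausdorffMeasure_image]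
  refine ⟨?_, fun f => ?_⟩
  · rw [hmeas]
    exact (isCompact_convexHull_range b).measure_lt_top
  · have hemb : MeasurableEmbedding φ := hiso.isClosedEmbedding.measurableEmbedding
    have h1 := setIntegral_convexHull_affineMap (μHE[m] : Measure U) b (f.comp φ)
    have hc : Measure.restrict (μHE[m] : Measure V) (convexHull ℝ (range p)) =
        Measure.restrict ((μHE[m] : Measure U).map φ) (convexHull ℝ (range p)) := by
      rw [hiso.map_euclideanHausdorffMeasure, Measure.restrict_restrict_of_subset]
      rw [← himg]
      exact image_subset_range _ _
    rw [hc, hemb.setIntegral_map, ← himg, preimage_image_eq _ hiso.injective]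
    refine h1.trans ?_
    rw [himg, measureReal_def, measureReal_def, hmeas, hm]
    push_cast
    congr 3
    exact funext fun i => congrArg f (congrFun hq i)

end Facet

/-! ### Faces of a cell, and the volume of a cone. -/

section Cone

variable {d : ℕ}

theorem facet_eq (s : Affine.Simplex ℝ (Vec d) d) (i : Fin (d + 1)) :
    facet s i = convexHull ℝ (range fun j : {j // j ≠ i} => s.points j) := by
  rw [facet, facetVertices]
  congr 1
  ext x
  simp

theorem isCompact_hull (s : Affine.Simplex ℝ (Vec d) d) : IsCompact (hull s) :=
  isCompact_convexHull_range _

theorem isCompact_facet (s : Affine.Simplex ℝ (Vec d) d) (i : Fin (d + 1)) :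
    IsCompact (facet s i) := by
  rw [facet_eq]
  exact isCompact_convexHull_range _

/-- The affine basis given by the vertices of a simplex of full dimension. -/
noncomputable def vertexBasis (s : Affine.Simplex ℝ (Vec d) d) :
    AffineBasis (Fin (d + 1)) ℝ (Vec d) :=
  ⟨s.points, s.independent,
    s.independent.affineSpan_eq_top_iff_card_eq_finrank_add_one.2 (by simp)⟩

@[simp] theorem coe_vertexBasis (s : Affine.Simplex ℝ (Vec d) d) :
    (vertexBasis s : Fin (d + 1) → Vec d) = s.points := rfl

theorem volume_hull_pos (s : Affine.Simplex ℝ (Vec d) d) : 0 < volume.real (hull s) := by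
  have h : (interior (hull s)).Nonempty :=
    interior_convexHull_nonempty_iff_affineSpan_eq_top.2 (vertexBasis s).tot
  exact ENNReal.toReal_pos (Measure.measure_pos_of_nonempty_interior _ h).ne'
    (isCompact_hull s).measure_lt_top.ne

theorem measure_facet_lt_top (hd : d ≠ 0) (s : Affine.Simplex ℝ (Vec d) d) (i : Fin (d + 1)) :
    μHE[d - 1] (facet s i) < ⊤ := by
  rw [facet_eq]
  refine (setIntegral_euclideanHausdorffMeasure_convexHull
    (s.independent.comp_embedding (Function.Embedding.subtype _)) ?_).1
  simp
  omega

theorem setIntegral_facet_affineMap (hd : d ≠ 0) (s : Affine.Simplex ℝ (Vec d) d)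
    (i : Fin (d + 1)) (f : Vec d →ᵃ[ℝ] ℝ) :
    ∫ x in facet s i, f x ∂μHE[d - 1] =
      (μHE[d - 1] : Measure (Vec d)).real (facet s i) *
        ((∑ j ∈ Finset.univ.erase i, f (s.points j)) / d) := by
  rw [facet_eq]
  have := (setIntegral_euclideanHausdorffMeasure_convexHull (m := d - 1)
    (s.independent.comp_embedding (Function.Embedding.subtype (· ≠ i)))
    (by simp; omega)).2 f
  have hd' : ((d - 1 : ℕ) : ℝ) + 1 = d := by
    rw [Nat.cast_sub (by omega)]
    simp
  rw [hd'] at this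
  refine this.trans ?_
  congr 2
  rw [Finset.sum_subtype (p := (· ≠ i)) _ (by simp)]
  rfl

theorem inner_sub_eq_of_mem_facet {s : Affine.Simplex ℝ (Vec d) d} {i : Fin (d + 1)} {n : Vec d}
    {h : ℝ} (hn : ∀ j, j ≠ i → inner ℝ n (s.points j - s.points i) = h) {x : Vec d}
    (hx : x ∈ facet s i) : inner ℝ n (x - s.points i) = h := by
  have hc : Convex ℝ {x : Vec d | inner ℝ n (x - s.points i) = h} := by
    have : {x : Vec d | inner ℝ n (x - s.points i) = h} =
        {x | inner ℝ n x = h + inner ℝ n (s.points i)} := by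
      ext x
      simp [inner_sub_right, sub_eq_iff_eq_add]
    rw [this]
    exact convex_hyperplane (innerₗ (Vec d) n).isLinear _
  refine convexHull_min ?_ hc hx
  rintro _ ⟨j, hj, rfl⟩
  exact hn j hj

/-- The simplex is the cone over a face with apex the opposite vertex; in this form its slices
parallel to the face are visibly scaled copies of the face. -/
theorem mem_hull_iff (hd : d ≠ 0) (s : Affine.Simplex ℝ (Vec d) d) (i : Fin (d + 1)) (x : Vec d) :
    x ∈ hull s ↔ ∃ t ∈ Icc (0 : ℝ) 1, ∃ z ∈ facet s i,
      x = AffineMap.homothety (s.points i) t z := by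
  have hne : (facetVertices s i).Nonempty := by
    have : Nontrivial (Fin (d + 1)) := Fin.nontrivial_iff_two_le.2 (by omega)
    obtain ⟨j, hj⟩ := exists_ne i
    exact ⟨_, j, hj, rfl⟩
  have : hull s = convexHull ℝ (insert (s.points i) (facetVertices s i)) := by
    rw [hull, facetVertices, ← image_insert_eq, ← image_univ]
    congr 2
    ext j
    simp [em]
  rw [this, convexHull_insert hne, mem_convexJoin]
  simp only [mem_singleton_iff, exists_eq_left, segment_eq_image_lineMap]
  constructor
  · rintro ⟨z, hz, t, ht, rfl⟩
    exact ⟨t, ht, z, hz, by rw [AffineMap.homothety_eq_lineMap]⟩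
  · rintro ⟨t, ht, z, hz, rfl⟩
    exact ⟨z, hz, t, ht, by rw [AffineMap.homothety_eq_lineMap]⟩

/-- The volume of a cone: `d |K| = h |F|` for a face `F` of `K` and the height `h` over it. -/
theorem volume_hull_eq (hd : d ≠ 0) (s : Affine.Simplex ℝ (Vec d) d) (i : Fin (d + 1)) {n : Vec d}
    (hn1 : ‖n‖ = 1) {h : ℝ} (hh : 0 < h)
    (hn : ∀ j, j ≠ i → inner ℝ n (s.points j - s.points i) = h) :
    d * volume.real (hull s) = h * (μHE[d - 1] : Measure (Vec d)).real (facet s i) := by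
  have hn0 : n ≠ 0 := by
    rintro rfl
    simp at hn1
  set m := μHE[d - 1] (facet s i) with hm
  have hmt : m < ⊤ := measure_facet_lt_top hd s i
  have hmem : ∀ (x : ℝ) (y : Vec d), y ∈ AffineSubspace.mk' (x • n +ᵥ s.points i) (ℝ ∙ n)ᗮ ↔
      inner ℝ n (y - s.points i) = x := by
    intro x y
    rw [AffineSubspace.mem_mk', Submodule.mem_orthogonal_singleton_iff_inner_right]
    simp only [vsub_eq_sub, vadd_eq_add, inner_sub_right, inner_add_right, inner_smul_right,
      real_inner_self_eq_norm_sq, hn1]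
    constructor <;> intro h <;> linarith
  have hinner : ∀ t, ∀ z ∈ facet s i,
      inner ℝ n (AffineMap.homothety (s.points i) t z - s.points i) = t * h := by
    intro t z hz
    rw [AffineMap.homothety_apply, vsub_eq_sub, vadd_eq_add, add_sub_cancel_right,
      inner_smul_right, inner_sub_eq_of_mem_facet hn hz]
  -- The slice at distance `x` from the apex is the face scaled by `x / h`. The level of the apex is
  -- left out since the scaling rule needs a nonzero ratio; one level is null in the integral over
  -- `x`.
  have hslice : ∀ x : ℝ, x ≠ 0 →
      μHE[d - 1] (hull s ∩ AffineSubspace.mk' (x • n +ᵥ s.points i) (ℝ ∙ n)ᗮ) =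
        (Ioc 0 h).indicator (fun x => ENNReal.ofReal ((x / h) ^ (d - 1)) * m) x := by
    intro x hx
    by_cases hxh : x ∈ Ioc 0 h
    · have hset : hull s ∩ AffineSubspace.mk' (x • n +ᵥ s.points i) (ℝ ∙ n)ᗮ =
          AffineMap.homothety (s.points i) (x / h) '' facet s i := by
        ext y
        simp only [mem_inter_iff, SetLike.mem_coe, hmem, mem_image]
        constructor
        · rintro ⟨hy, hyx⟩
          obtain ⟨t, ht, z, hz, rfl⟩ := (mem_hull_iff hd s i y).1 hy
          refine ⟨z, hz, ?_⟩
          rw [hinner t z hz] at hyx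
          rw [← hyx, mul_div_cancel_right₀ _ hh.ne']
        · rintro ⟨z, hz, rfl⟩
          refine ⟨(mem_hull_iff hd s i _).2 ⟨x / h, ⟨?_, ?_⟩, z, hz, rfl⟩, ?_⟩
          · exact div_nonneg hxh.1.le hh.le
          · exact (div_le_one hh).2 hxh.2
          · rw [hinner _ z hz, div_mul_cancel₀ _ hh.ne']
      rw [hset, euclideanHausdorffMeasure_homothety_image _ _ (div_ne_zero hx hh.ne'),
        indicator_of_mem hxh, ENNReal.smul_def, smul_eq_mul, hm]
      congr 1
      have h0 : 0 ≤ x / h := div_nonneg hxh.1.le hh.le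
      rw [ENNReal.ofReal_pow h0, ENNReal.coe_pow]
      congr 1
      rw [← Real.enorm_of_nonneg h0]
      rfl
    · rw [indicator_of_notMem hxh]
      convert measure_empty (μ := μHE[d - 1])
      rw [eq_empty_iff_forall_notMem]
      rintro y ⟨hy, hyx⟩
      rw [SetLike.mem_coe, hmem] at hyx
      obtain ⟨t, ht, z, hz, rfl⟩ := (mem_hull_iff hd s i y).1 hy
      rw [hinner t z hz] at hyx
      subst hyx
      refine hxh ⟨lt_of_le_of_ne (mul_nonneg ht.1 hh.le) hx.symm, ?_⟩
      nlinarith [ht.2]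
  have key := EuclideanGeometry.euclideanHausdorffMeasure_eq_lintegral (s.points i) hn0
    (isCompact_hull s).measurableSet
  rw [finrank_euclideanSpace_fin, EuclideanSpace.euclideanHausdorffMeasure_eq_volume,
    ← ofReal_norm, hn1, ENNReal.ofReal_one, one_mul,
    lintegral_congr_ae ((Measure.ae_ne volume (0 : ℝ)).mono hslice),
    lintegral_indicator measurableSet_Ioc, lintegral_mul_const _ (by fun_prop),
    ← ofReal_integral_eq_lintegral_ofReal] at key
  · rw [measureReal_def, measureReal_def, key, ENNReal.toReal_mul, ← hm,
      ENNReal.toReal_ofReal (setIntegral_nonneg measurableSet_Ioc fun x hx =>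
        pow_nonneg (div_nonneg hx.1.le hh.le) _),
      ← intervalIntegral.integral_of_le hh.le]
    have hd1 : ((d - 1 : ℕ) : ℝ) + 1 = d := by
      rw [Nat.cast_sub (by omega)]
      simp
    have hd2 : (d : ℝ) ≠ 0 := by exact_mod_cast hd
    -- Cavalieri's principle has reduced the volume to `|F| ∫₀ʰ (x / h)^(d-1) dx = |F| h / d`.
    rw [intervalIntegral.integral_comp_div (fun x => x ^ (d - 1)) hh.ne', integral_pow, hd1,
      zero_div, div_self hh.ne', Nat.sub_add_cancel (by omega)]
    simp [hd]
    field_simp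
  · exact (by fun_prop : Continuous fun x : ℝ => (x / h) ^ (d - 1)).integrableOn_Ioc
  · exact (ae_restrict_mem measurableSet_Ioc).mono fun x hx =>
      pow_nonneg (div_nonneg hx.1.le hh.le) _

end Cone

/-! ### The divergence theorem for affine fields on a simplex. -/

section Divergence

variable {d : ℕ}

theorem fderiv_affineMap {V W : Type*} [NormedAddCommGroup V] [NormedSpace ℝ V]
    [FiniteDimensional ℝ V] [NormedAddCommGroup W] [NormedSpace ℝ W] (A : V →ᵃ[ℝ] W) (x : V) :
    fderiv ℝ A x = LinearMap.toContinuousLinearMap A.linear := by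
  have h : (A : V → W) = fun y => LinearMap.toContinuousLinearMap A.linear y + A 0 := by
    ext1 y
    exact congrFun (AffineMap.decomp A) y
  rw [h]
  exact ((LinearMap.toContinuousLinearMap A.linear).hasFDerivAt.add_const _).fderiv

theorem divg_affineMap (A : Vec d →ᵃ[ℝ] Vec d) (x : Vec d) :
    divg A x = ∑ k, A.linear (EuclideanSpace.single k 1) k := by
  simp [divg, fderiv_affineMap]

/-- The divergence theorem for affine vector fields on a simplex. -/
theorem setIntegral_divg_hull (hd : d ≠ 0) (s : Affine.Simplex ℝ (Vec d) d)
    (n : Fin (d + 1) → Vec d) (hn1 : ∀ i, ‖n i‖ = 1)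
    (horth : ∀ i j k, j ≠ i → k ≠ i → inner ℝ (n i) (s.points j - s.points k) = 0)
    (hout : ∀ i j, j ≠ i → inner ℝ (n i) (s.points i - s.points j) < 0)
    (A : Vec d →ᵃ[ℝ] Vec d) :
    ∫ x in hull s, divg A x =
      ∑ i, ∫ x in facet s i, inner ℝ (A x) (n i) ∂μHE[d - 1] := by
  have : Nontrivial (Fin (d + 1)) := Fin.nontrivial_iff_two_le.2 (by omega)
  have hd' : (d : ℝ) ≠ 0 := by exact_mod_cast hd
  choose j₀ hj₀ using fun i : Fin (d + 1) => exists_ne i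
  set h : Fin (d + 1) → ℝ := fun i => inner ℝ (n i) (s.points (j₀ i) - s.points i) with hdef
  have hpos : ∀ i, 0 < h i := fun i => by
    have := hout i _ (hj₀ i)
    rw [← neg_sub, inner_neg_right] at this
    simpa [hdef] using this
  have hh : ∀ i j, j ≠ i → inner ℝ (n i) (s.points j - s.points i) = h i := fun i j hj => by
    have := horth i j (j₀ i) hj (hj₀ i)
    simp only [hdef, inner_sub_right] at this ⊢
    linarith
  let b := vertexBasis s
  -- Both sides are affine in `x` and agree at the vertices. Thus the gradient of the `i`-th
  -- barycentric coordinate is `-n i / h i`.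
  have hcoord : ∀ i x, inner ℝ (n i) (x - s.points i) = h i * (1 - b.coord i x) := fun i x => by
    have h2 : ∀ j, (inner ℝ (n i) (b j) - inner ℝ (n i) (s.points i) : ℝ) =
        h i * (1 - if j = i then 1 else 0) := fun j => by
      rw [← inner_sub_right]
      rcases eq_or_ne j i with rfl | hj
      · simp [b]
      · simp [b, hj, hh i j hj]
    have h1 : (inner ℝ (n i) x - inner ℝ (n i) (s.points i) : ℝ) =
        ∑ j, b.coord j x * (h i * (1 - if j = i then 1 else 0)) :=
      (affineMap_eq_sum_coord b ((innerₗ (Vec d) (n i)).toAffineMap -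
        AffineMap.const ℝ _ (inner ℝ (n i) (s.points i))) x).trans
        (Finset.sum_congr rfl fun j _ => congrArg (b.coord j x * ·) (h2 j))
    rw [inner_sub_right, h1]
    have h3 : ∀ j, b.coord j x * (h i * (1 - if j = i then (1 : ℝ) else 0)) =
        h i * b.coord j x - if j = i then h i * b.coord j x else 0 := fun j => by
      split_ifs <;> ring
    simp only [h3, Finset.sum_sub_distrib, Finset.sum_ite_eq', Finset.mem_univ, if_true,
      ← Finset.mul_sum, b.sum_coord_apply_eq_one]
    ring
  have hlin : ∀ i v, b.coord i v - b.coord i 0 = -(inner ℝ (n i) v / h i) := fun i v => by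
    have h1 := hcoord i v
    have h2 := hcoord i 0
    rw [inner_sub_right] at h1 h2
    rw [inner_zero_right] at h2
    have := (hpos i).ne'
    field_simp
    linarith
  -- The gradients of the barycentric coordinates sum to zero, because the coordinates sum to 1.
  have hzero : ∀ v, ∑ i, inner ℝ (n i) v / h i = 0 := fun v => by
    have : ∑ i, (b.coord i v - b.coord i 0) = 0 := by
      rw [Finset.sum_sub_distrib, b.sum_coord_apply_eq_one, b.sum_coord_apply_eq_one, sub_self]
    simpa [hlin] using this
  have hA : ∀ v, A.linear v = -∑ i, (inner ℝ (n i) v / h i) • A (s.points i) := fun v => by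
    have h1 : A.linear v = A v - A 0 := by
      simpa using (A.linearMap_vsub v 0)
    rw [h1, affineMap_eq_sum_coord b A v, affineMap_eq_sum_coord b A 0, ← Finset.sum_sub_distrib]
    simp only [← sub_smul, hlin, neg_smul, Finset.sum_neg_distrib]
    rfl
  have htr : ∑ k, A.linear (EuclideanSpace.single k 1) k =
      -∑ i, inner ℝ (n i) (A (s.points i)) / h i := by
    simp only [hA, PiLp.neg_apply, WithLp.ofLp_sum, Finset.sum_apply, PiLp.smul_apply, smul_eq_mul,
      Finset.sum_neg_distrib, EuclideanSpace.inner_single_right]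
    rw [Finset.sum_comm]
    congr 1
    refine Finset.sum_congr rfl fun i _ => ?_
    rw [PiLp.inner_apply, Finset.sum_div]
    refine Finset.sum_congr rfl fun k _ => ?_
    simp
    ring
  -- Uses `|F i| / d = |K| / h i`. After summation over `i` the full sum over `j` vanishes by
  -- `hzero`, and the subtracted terms are the trace of the linear part of `A`.
  have hfacet : ∀ i, ∫ x in facet s i, inner ℝ (A x) (n i) ∂μHE[d - 1] =
      volume.real (hull s) * (∑ j, inner ℝ (n i) (A (s.points j)) / h i -
        inner ℝ (n i) (A (s.points i)) / h i) := fun i => by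
    have h1 := setIntegral_facet_affineMap hd s i ((innerₗ (Vec d) (n i)).toAffineMap.comp A)
    simp only [AffineMap.comp_apply, LinearMap.coe_toAffineMap, innerₗ_apply_apply] at h1
    simp only [real_inner_comm (n i)]
    have h2 := volume_hull_eq hd s i (hn1 i) (hpos i) (hh i)
    rw [h1, Finset.sum_erase_eq_sub (Finset.mem_univ i), ← Finset.sum_div]
    have := (hpos i).ne'
    field_simp
    linear_combination
      -(∑ x, inner ℝ (n i) (A (s.points x)) - inner ℝ (n i) (A (s.points i))) * h2
  rw [Finset.sum_congr rfl fun i _ => hfacet i, ← Finset.mul_sum, Finset.sum_sub_distrib,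
    Finset.sum_comm]
  simp only [hzero, divg_affineMap, htr, setIntegral_const, smul_eq_mul]
  simp

end Divergence

/-! ### Face integrals on the mesh and discrete integration by parts. -/

namespace Mesh

variable {d : ℕ} (M : Mesh d)

theorem area_nonneg (σ : M.IFace) : 0 ≤ M.area σ := measureReal_nonneg

theorem faceIntegral_const (σ : M.IFace) (c : ℝ) :
    M.faceIntegral σ (fun _ => c) = M.area σ * c := by
  simp [faceIntegral, facetIntegral, area]

/-- The volume of a cell. -/
noncomputable def vol (K : M.Cell) : ℝ := volume.real (hull (M.simplex K))

theorem vol_pos (K : M.Cell) : 0 < M.vol K := volume_hull_pos _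

theorem integral_const (c : M.Cell → ℝ) : M.integral (fun K _ => c K) = ∑ K, M.vol K * c K := by
  simp [integral, vol]

theorem meshSize_nonneg : 0 ≤ M.meshSize := Real.iSup_nonneg fun _ => Metric.diam_nonneg

/-- Since `D_t(ρ û)` is constant on cells, the momentum equation sees the test function in this term
only through its mean. -/
theorem setIntegral_hull_inner {v : M.Broken (Vec d)} {K : M.Cell} (hv : Continuous (v K))
    (c : Vec d) :
    ∫ x in hull (M.simplex K), inner ℝ c (v K x) = M.vol K * inner ℝ c (M.hat v K) := by
  rw [integral_inner (hv.continuousOn.integrableOn_compact (isCompact_hull _)), hat,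
    setAverage_eq, inner_smul_right, vol, mul_inv_cancel_left₀ (volume_hull_pos _).ne']

/-- Undoes the normalisation in `u_σ`. If the area were zero both sides would vanish, so positivity
of face areas is not needed. -/
theorem area_mul_normalVel (hd : d ≠ 0) (u : M.Broken (Vec d)) (σ : M.IFace) :
    M.area σ * M.normalVel u σ =
      M.facetIntegral (M.inn σ).1 (M.inn σ).2
        (fun x => inner ℝ (u (M.inn σ).1 x) (M.normal (M.inn σ).1 (M.inn σ).2)) := by
  rcases eq_or_ne (M.area σ) 0 with h | h
  · rw [h, zero_mul, facetIntegral, setIntegral_measure_zero]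
    rwa [area, measureReal_eq_zero_iff (measure_facet_lt_top hd _ _).ne] at h
  · rw [normalVel, mul_inv_cancel_left₀ h]
    rfl

theorem facet_inn (σ : M.IFace) : facet (M.simplex (M.inn σ).1) (M.inn σ).2 =
    (fun x => M.shift σ + x) '' facet (M.simplex (M.out σ).1) (M.out σ).2 := by
  rw [facet, M.face_match, facet]
  exact (((AffineEquiv.constVAdd ℝ (Vec d) (M.shift σ)) : Vec d →ᵃ[ℝ] Vec d).image_convexHull
    _).symm

theorem facetIntegral_inn (σ : M.IFace) {F : Type} [NormedAddCommGroup F] [NormedSpace ℝ F]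
    (f : Vec d → F) :
    M.facetIntegral (M.inn σ).1 (M.inn σ).2 (fun x => f (x - M.shift σ)) =
      M.facetIntegral (M.out σ).1 (M.out σ).2 f := by
  rw [facetIntegral, facetIntegral, facet_inn]
  have h := (IsometryEquiv.addLeft (M.shift σ)).measurePreserving_euclideanHausdorffMeasure (d - 1)
  have := h.setIntegral_image_emb
    (IsometryEquiv.addLeft (M.shift σ)).toHomeomorph.measurableEmbedding
    (fun x => f (x - M.shift σ)) (facet (M.simplex (M.out σ).1) (M.out σ).2)
  simpa using this

theorem facetIntegral_inner (hd : d ≠ 0) {K : M.Cell} {i : Fin (d + 1)} {f : Vec d → Vec d}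
    (hf : Continuous f) (c : Vec d) :
    M.facetIntegral K i (fun x => inner ℝ (f x) c) = inner ℝ (M.facetIntegral K i f) c := by
  have : IntegrableOn f (facet (M.simplex K) i) μHE[d - 1] :=
    hf.continuousOn.integrableOn_of_subset_isCompact (isCompact_facet _ _)
      (isCompact_facet _ _).measurableSet subset_rfl (measure_facet_lt_top hd _ _).ne
  simp only [real_inner_comm c]
  exact integral_inner this c

/-- Integration by parts for Crouzeix–Raviart functions against piecewise constants. -/
theorem integral_mul_divg (hd : d ≠ 0) {u : M.Broken (Vec d)} (hu : u ∈ M.CR₀) (p : M.Cell → ℝ) :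
    M.integral (fun K x => p K * divg (u K) x) =
      -∑ σ, M.area σ * (M.normalVel u σ * M.jumpC p σ) := by
  obtain ⟨haff, hjump, hext⟩ := hu
  have hcont : ∀ K, Continuous (u K) := fun K => by
    obtain ⟨A, hA⟩ := haff K
    rw [show u K = A from funext hA]
    exact A.continuous_of_finiteDimensional
  let G : M.Cell × Fin (d + 1) → ℝ := fun q =>
    M.facetIntegral q.1 q.2 (fun x => inner ℝ (u q.1 x) (M.normal q.1 q.2))
  have hdiv : ∀ K, ∫ x in hull (M.simplex K), divg (u K) x = ∑ i, G (K, i) := fun K => by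
    obtain ⟨A, hA⟩ := haff K
    simp only [G]
    rw [show u K = A from funext hA]
    exact setIntegral_divg_hull hd _ _ (M.normal_unit K) (M.normal_orth K) (M.normal_outward K) A
  have hGin : ∀ σ, G (M.inn σ) = M.area σ * M.normalVel u σ := fun σ =>
    (M.area_mul_normalVel hd u σ).symm
  -- The vanishing mean jump makes the integrals of `u` from the two sides equal, and the outward
  -- normals are opposite.
  have hGout : ∀ σ, G (M.out σ) = -(M.area σ * M.normalVel u σ) := fun σ => by
    have hint : ∀ f : Vec d → Vec d, Continuous f →
        IntegrableOn f (facet (M.simplex (M.inn σ).1) (M.inn σ).2) μHE[d - 1] := fun f hf =>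
      hf.continuousOn.integrableOn_of_subset_isCompact (isCompact_facet _ _)
      (isCompact_facet _ _).measurableSet subset_rfl (measure_facet_lt_top hd _ _).ne
    have h1 : M.facetIntegral (M.out σ).1 (M.out σ).2 (u (M.out σ).1) =
        M.facetIntegral (M.inn σ).1 (M.inn σ).2 (u (M.inn σ).1) := by
      rw [← facetIntegral_inn, ← sub_eq_zero, ← hjump σ]
      exact (integral_sub (hint _ ((hcont _).comp (continuous_sub_right _)))
        (hint _ (hcont _))).symm
    rw [← hGin]
    simp only [G]
    rw [facetIntegral_inner M hd (hcont _), facetIntegral_inner M hd (hcont _), h1,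
      M.normal_opposite, inner_neg_right]
  have hGext : ∀ q, q ∉ range (Sum.elim M.inn M.out) → G q = 0 := fun q hq => by
    simp only [G]
    rw [facetIntegral_inner M hd (hcont _), hext q.1 q.2, inner_zero_left]
    intro σ
    exact ⟨fun h => hq ⟨Sum.inl σ, h⟩, fun h => hq ⟨Sum.inr σ, h⟩⟩
  calc M.integral (fun K x => p K * divg (u K) x)
      = ∑ q : M.Cell × Fin (d + 1), p q.1 * G q := by
        simp only [integral, integral_const_mul, hdiv, Finset.mul_sum, Fintype.sum_prod_type]
    -- Regroups the sum over pairs (cell, face of it): sides of interior faces are counted once by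
    -- injectivity, and every remaining pair is an exterior face, where the flux is zero.
    _ = ∑ τ : M.IFace ⊕ M.IFace, p (Sum.elim M.inn M.out τ).1 * G (Sum.elim M.inn M.out τ) := by
        classical
        rw [← Finset.sum_image (s := Finset.univ) (f := fun q => p q.1 * G q)
          (g := Sum.elim M.inn M.out) M.face_inj.injOn]
        refine (Finset.sum_subset (Finset.subset_univ _) fun q _ hq => ?_).symm
        rw [hGext q (by simpa using hq), mul_zero]
    _ = _ := by
        rw [Fintype.sum_sum_type, ← Finset.sum_add_distrib, ← Finset.sum_neg_distrib]
        refine Finset.sum_congr rfl fun σ _ => ?_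
        simp only [Sum.elim_inl, Sum.elim_inr, hGin, hGout, jumpC]
        ring

end Mesh

/-! ### Mean value lemmas with intermediate points. -/

section MeanValue

variable {f f' f'' : ℝ → ℝ} {x y : ℝ}

/-- Second order Taylor expansion with Lagrange remainder, on either side of the base point. -/
theorem exists_taylor_two (hf : ∀ z ∈ uIcc x y, HasDerivAt f (f' z) z)
    (hf' : ∀ z ∈ uIcc x y, HasDerivAt f' (f'' z) z) :
    ∃ ξ ∈ uIcc x y, f' y * (y - x) - (f y - f x) = 1 / 2 * f'' ξ * (y - x) ^ 2 := by
  rcases eq_or_ne x y with rfl | hxy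
  · exact ⟨x, left_mem_uIcc, by simp⟩
  have hxy' : x - y ≠ 0 := sub_ne_zero.2 hxy
  -- Chosen so that the auxiliary function `g` below takes equal values at `x` and `y`. Rolle's
  -- theorem then gives an interior zero of `g'`, where the factor `x - ξ` cannot vanish.
  set C := (f x - f y - f' y * (x - y)) / (x - y) ^ 2 with hC
  let g : ℝ → ℝ := fun s => f s + f' s * (x - s) + C * (x - s) ^ 2
  have hg : ∀ z ∈ uIcc x y, HasDerivAt g ((f'' z - 2 * C) * (x - z)) z := fun z hz => by
    have h1 : HasDerivAt (fun s => x - s) (-1) z := by simpa using (hasDerivAt_id z).const_sub x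
    refine (((hf z hz).add ((hf' z hz).mul h1)).add ((h1.pow 2).const_mul C)).congr_deriv ?_
    norm_num
    ring
  have hxy2 : g x = g y := by
    simp only [g, hC]
    field_simp
    ring
  have hroot : ∃ ξ ∈ uIcc x y, ξ ≠ x ∧ (f'' ξ - 2 * C) * (x - ξ) = 0 := by
    rcases lt_or_gt_of_ne hxy with h | h
    · rw [uIcc_of_le h.le] at hg ⊢
      obtain ⟨ξ, hξ, h0⟩ := exists_hasDerivAt_eq_zero h
        (fun z hz => (hg z hz).continuousAt.continuousWithinAt) hxy2
        (fun z hz => hg z (Ioo_subset_Icc_self hz))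
      exact ⟨ξ, Ioo_subset_Icc_self hξ, hξ.1.ne', h0⟩
    · rw [uIcc_of_ge h.le] at hg ⊢
      obtain ⟨ξ, hξ, h0⟩ := exists_hasDerivAt_eq_zero h
        (fun z hz => (hg z hz).continuousAt.continuousWithinAt) hxy2.symm
        (fun z hz => hg z (Ioo_subset_Icc_self hz))
      exact ⟨ξ, Ioo_subset_Icc_self hξ, hξ.2.ne, h0⟩
  obtain ⟨ξ, hξ, hne, h0⟩ := hroot
  refine ⟨ξ, hξ, ?_⟩
  have h2 : f'' ξ = 2 * C := by
    rcases mul_eq_zero.1 h0 with h | h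
    · linarith
    · exact absurd (sub_eq_zero.1 h).symm hne
  rw [h2, hC]
  field_simp
  ring

theorem exists_sub_eq_deriv_mul (hf' : ∀ z ∈ uIcc x y, HasDerivAt f' (f'' z) z) :
    ∃ ζ ∈ uIcc x y, f' y - f' x = f'' ζ * (y - x) := by
  rcases lt_trichotomy x y with h | rfl | h
  · rw [uIcc_of_le h.le] at hf' ⊢
    obtain ⟨ζ, hζ, h0⟩ := exists_hasDerivAt_eq_slope f' f'' h
      (fun z hz => (hf' z hz).continuousAt.continuousWithinAt)
      (fun z hz => hf' z (Ioo_subset_Icc_self hz))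
    exact ⟨ζ, Ioo_subset_Icc_self hζ, by rw [h0, div_mul_cancel₀ _ (sub_ne_zero.2 h.ne')]⟩
  · exact ⟨x, left_mem_uIcc, by simp⟩
  · rw [uIcc_of_ge h.le] at hf' ⊢
    obtain ⟨ζ, hζ, h0⟩ := exists_hasDerivAt_eq_slope f' f'' h
      (fun z hz => (hf' z hz).continuousAt.continuousWithinAt)
      (fun z hz => hf' z (Ioo_subset_Icc_self hz))
    refine ⟨ζ, Ioo_subset_Icc_self hζ, ?_⟩
    rw [h0]
    have := sub_ne_zero.2 h.ne'
    field_simp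
    ring

/-- A weighted mean of two values of a continuous function is attained in between. -/
theorem exists_weighted_mean_eq {g : ℝ → ℝ} (hg : ContinuousOn g (uIcc x y)) {s t α β : ℝ}
    (hs : s ∈ uIcc x y) (ht : t ∈ uIcc x y) (hα : 0 ≤ α) (hβ : 0 ≤ β) :
    ∃ ζ ∈ uIcc x y, α * g s + β * g t = (α + β) * g ζ := by
  rcases (add_nonneg hα hβ).eq_or_lt with h | h
  · have h1 : α = 0 := by linarith
    have h2 : β = 0 := by linarith
    exact ⟨s, hs, by simp [h1, h2]⟩
  have hsub : uIcc s t ⊆ uIcc x y := uIcc_subset_uIcc hs ht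
  have hmem : (α / (α + β)) • g s + (β / (α + β)) • g t ∈ uIcc (g s) (g t) := by
    rw [← segment_eq_uIcc]
    exact ⟨_, _, div_nonneg hα h.le, div_nonneg hβ h.le, by field_simp, rfl⟩
  obtain ⟨ζ, hζ, h0⟩ := intermediate_value_uIcc (hg.mono hsub) hmem
  refine ⟨ζ, hsub hζ, ?_⟩
  rw [h0]
  simp only [smul_eq_mul]
  field_simp

end MeanValue

/-! ### The pressure potential and the dissipation of internal energy. -/

namespace Params

variable (P : Params)

/-- The first derivative `H'`. -/
noncomputable def dH (r : ℝ) : ℝ := P.a / (P.γ - 1) * (P.γ * r ^ (P.γ - 1))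

variable {P} {r : ℝ}

theorem hasDerivAt_H (hr : 0 < r) : HasDerivAt P.H (P.dH r) r :=
  (Real.hasDerivAt_rpow_const (Or.inl hr.ne')).const_mul _

theorem hasDerivAt_dH_rpow (hr : 0 < r) : HasDerivAt P.dH
    (P.a / (P.γ - 1) * (P.γ * ((P.γ - 1) * r ^ (P.γ - 1 - 1)))) r :=
  ((Real.hasDerivAt_rpow_const (Or.inl hr.ne')).const_mul _).const_mul _

theorem H''_eq (hγ : 1 < P.γ) (hr : 0 < r) : P.H'' r = P.a * P.γ * r ^ (P.γ - 1 - 1) := by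
  -- `H''` is an iterated `deriv` on the whole line, so the formula for `H'` is needed on a
  -- neighbourhood of `r`.
  have h : deriv P.H =ᶠ[nhds r] P.dH := by
    filter_upwards [Ioi_mem_nhds hr] with s hs
    exact (hasDerivAt_H hs).deriv
  have := sub_ne_zero.2 hγ.ne'
  rw [H'', h.deriv_eq, (hasDerivAt_dH_rpow hr).deriv]
  field_simp

theorem hasDerivAt_dH (hγ : 1 < P.γ) (hr : 0 < r) : HasDerivAt P.dH (P.H'' r) r := by
  convert hasDerivAt_dH_rpow (P := P) hr using 1
  have := sub_ne_zero.2 hγ.ne'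
  rw [H''_eq hγ hr]
  field_simp

theorem H''_pos (ha : 0 < P.a) (hγ : 1 < P.γ) (hr : 0 < r) : 0 < P.H'' r := by
  rw [H''_eq hγ hr]
  have := Real.rpow_pos_of_pos hr (P.γ - 1 - 1)
  have : 0 < P.γ := by linarith
  positivity

theorem continuousOn_H'' (hγ : 1 < P.γ) : ContinuousOn P.H'' (Ioi 0) := by
  have : ContinuousOn (fun r : ℝ => P.a * P.γ * r ^ (P.γ - 1 - 1)) (Ioi 0) :=
    continuousOn_const.mul (continuousOn_id.rpow_const fun x hx => Or.inl (ne_of_gt hx))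
  exact this.congr fun r hr => H''_eq hγ hr

/-- The thermodynamic relation that lets pressure work be absorbed by the continuity equation tested
with `H'(ρ)`. -/
theorem p_eq (hγ : 1 < P.γ) (hr : 0 < r) : P.p r = r * P.dH r - P.H r := by
  have h : r ^ P.γ = r * r ^ (P.γ - 1) := by
    rw [Real.rpow_sub_one hr.ne']
    field_simp
  have := sub_ne_zero.2 hγ.ne'
  rw [p, dH, H, h]
  field_simp

theorem exists_taylor_H (hγ : 1 < P.γ) {x y : ℝ} (hx : 0 < x) (hy : 0 < y) :
    ∃ ξ ∈ uIcc x y, P.dH y * (y - x) - (P.H y - P.H x) = 1 / 2 * P.H'' ξ * (y - x) ^ 2 := by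
  have hpos : ∀ z ∈ uIcc x y, 0 < z := fun z hz => (lt_min hx hy).trans_le hz.1
  exact exists_taylor_two (fun z hz => hasDerivAt_H (hpos z hz))
    (fun z hz => hasDerivAt_dH hγ (hpos z hz))

/-- The renormalised balance of internal energy across a face: upwinding and artificial diffusion
dissipate with the same intermediate value `ζ`. -/
theorem exists_face_dissipation (hγ : 1 < P.γ) {x y w k : ℝ} (hx : 0 < x) (hy : 0 < y)
    (hk : 0 ≤ k) : ∃ ζ ∈ uIcc x y,
      -((w * (if 0 ≤ w then x else y) - k * (y - x)) * (P.dH y - P.dH x)) +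
        w * (P.p y - P.p x) = P.H'' ζ * (y - x) ^ 2 * (k + |w| / 2) := by
  have hpos : ∀ z ∈ uIcc x y, 0 < z := fun z hz => (lt_min hx hy).trans_le hz.1
  obtain ⟨ζ₁, hζ₁, h1⟩ := exists_sub_eq_deriv_mul (fun z hz => hasDerivAt_dH hγ (hpos z hz))
  -- After inserting `p = ρ H' - H`, the upwind part equals `|w|` times the Taylor remainder of `H`
  -- based at the downwind value, whence the two cases with `x` and `y` exchanged.
  have h2 : ∃ ζ₂ ∈ uIcc x y,
      -(w * (if 0 ≤ w then x else y) * (P.dH y - P.dH x)) + w * (P.p y - P.p x) =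
        |w| / 2 * P.H'' ζ₂ * (y - x) ^ 2 := by
    rw [p_eq hγ hx, p_eq hγ hy]
    split_ifs with hw
    · obtain ⟨ζ₂, hζ₂, h⟩ := exists_taylor_H hγ hx hy
      refine ⟨ζ₂, hζ₂, ?_⟩
      rw [abs_of_nonneg hw]
      linear_combination w * h
    · obtain ⟨ζ₂, hζ₂, h⟩ := exists_taylor_H hγ hy hx
      refine ⟨ζ₂, uIcc_comm x y ▸ hζ₂, ?_⟩
      rw [abs_of_neg (not_le.1 hw)]
      linear_combination -w * h
  obtain ⟨ζ₂, hζ₂, h2⟩ := h2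
  -- Diffusion produced `H'' ζ₁` with weight `k`, upwinding `H'' ζ₂` with weight `|w| / 2`;
  -- continuity of `H''` merges them into a single value.
  obtain ⟨ζ, hζ, h3⟩ := exists_weighted_mean_eq
    ((continuousOn_H'' hγ).mono fun z hz => hpos z hz) hζ₁ hζ₂ hk
    (div_nonneg (abs_nonneg w) zero_le_two)
  refine ⟨ζ, hζ, ?_⟩
  linear_combination h2 + (y - x) ^ 2 * h3 + k * (y - x) * h1

end Params

/-! ### Algebraic identities for kinetic and magnetic energy. -/

section Kinetic

variable {V : Type*} [NormedAddCommGroup V] [InnerProductSpace ℝ V]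

/-- The upwind value of `ρ û` uses the same side for `ρ` and `û`. Subtracting the mass flux tested
with `½|û|²` therefore completes the square, in the upwind part and in the diffusive part
separately. -/
theorem kinetic_face_identity (a b : V) (x y w k : ℝ) :
    -inner ℝ (w • (if 0 ≤ w then x • a else y • b) - k • (y • b - x • a)) (b - a) +
      (w * (if 0 ≤ w then x else y) - k * (y - x)) * (1 / 2 * ‖b‖ ^ 2 - 1 / 2 * ‖a‖ ^ 2) =
    ((if 0 ≤ w then x else y) * (|w| / 2) + k * ((y + x) / 2)) * ‖b - a‖ ^ 2 := by
  simp only [← real_inner_self_eq_norm_sq]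
  split_ifs with hw
  · rw [abs_of_nonneg hw]
    simp only [inner_sub_left, inner_sub_right, inner_smul_left, real_inner_comm a b,
      RCLike.conj_to_real]
    ring
  · rw [abs_of_neg (not_le.1 hw)]
    simp only [inner_sub_left, inner_sub_right, inner_smul_left, real_inner_comm a b,
      RCLike.conj_to_real]
    ring

/-- Removing the continuity equation tested with `½|b|²` leaves a square weighted by the old density
`x`, so the numerical dissipation is signed when the old density is nonnegative. -/
theorem kinetic_cell_identity {τ : ℝ} (hτ : 0 < τ) (a b : V) (x y : ℝ) :
    inner ℝ (τ⁻¹ • (y • b - x • a)) b - τ⁻¹ * (y - x) * (1 / 2 * ‖b‖ ^ 2) =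
      τ⁻¹ * (1 / 2 * y * ‖b‖ ^ 2 - 1 / 2 * x * ‖a‖ ^ 2) +
        τ / 2 * (x * ‖τ⁻¹ • (b - a)‖ ^ 2) := by
  simp only [← real_inner_self_eq_norm_sq]
  simp only [inner_sub_left, inner_sub_right, inner_smul_left, inner_smul_right,
    real_inner_comm a b, RCLike.conj_to_real]
  field_simp
  ring

theorem magnetic_identity {τ : ℝ} (hτ : 0 < τ) (a b : V) :
    inner ℝ (τ⁻¹ • (b - a)) b = τ⁻¹ * (1 / 2 * ‖b‖ ^ 2 - 1 / 2 * ‖a‖ ^ 2) +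
      τ / 2 * ‖τ⁻¹ • (b - a)‖ ^ 2 := by
  simp only [← real_inner_self_eq_norm_sq]
  simp only [inner_sub_left, inner_sub_right, inner_smul_left, inner_smul_right,
    real_inner_comm a b, RCLike.conj_to_real]
  field_simp
  ring

end Kinetic

/-! ### From decay over one time step to monotonicity. -/

section StepFunction

/-- The hypothesis compares only times at distance `τ`. A step function takes at `t` its value at
the grid point `⌈t/τ⌉ τ`, which reduces the claim to induction along the grid. -/
theorem antitoneOn_of_step {f : ℝ → ℝ} {τ : ℝ} (hτ : 0 < τ) {N : ℕ}
    (hstep : ∀ k : ℕ, 1 ≤ k → k ≤ N → ∀ t ∈ Ioc (((k : ℝ) - 1) * τ) (k * τ), f t = f (k * τ))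
    (hle : ∀ t ∈ Ioc 0 (N * τ), f t ≤ f (t - τ)) : AntitoneOn f (Icc 0 (N * τ)) := by
  have hceil : ∀ t ∈ Icc 0 (N * τ), ⌈t / τ⌉₊ ≤ N ∧ f t = f (⌈t / τ⌉₊ * τ) := fun t ht => by
    have hN : ⌈t / τ⌉₊ ≤ N := Nat.ceil_le.2 ((div_le_iff₀ hτ).2 ht.2)
    refine ⟨hN, ?_⟩
    rcases ht.1.eq_or_lt with rfl | h0
    · simp
    · have hpos : 0 < t / τ := div_pos h0 hτ
      refine hstep _ (Nat.one_le_ceil_iff.2 hpos) hN t ⟨?_, ?_⟩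
      · rw [← lt_div_iff₀ hτ, sub_lt_iff_lt_add]
        exact Nat.ceil_lt_add_one hpos.le
      · rw [← div_le_iff₀ hτ]
        exact Nat.le_ceil _
  have hmono : ∀ m n : ℕ, m ≤ n → n ≤ N → f (n * τ) ≤ f (m * τ) := fun m n hmn => by
    induction n, hmn using Nat.le_induction with
    | base => exact fun _ => le_rfl
    | succ n _ ih =>
      intro hn
      refine le_trans ?_ (ih (by omega))
      have hn' : ((n + 1 : ℕ) : ℝ) ≤ N := by exact_mod_cast hn
      have := hle ((n + 1 : ℕ) * τ) ⟨by positivity, mul_le_mul_of_nonneg_right hn' hτ.le⟩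
      rwa [show ((n + 1 : ℕ) : ℝ) * τ - τ = n * τ by push_cast; ring] at this
  intro s hs t ht hst
  obtain ⟨-, h1⟩ := hceil s hs
  obtain ⟨hN, h2⟩ := hceil t ht
  rw [h1, h2]
  exact hmono _ _ (Nat.ceil_mono (div_le_div_of_nonneg_right hst hτ.le)) hN

end StepFunction

/-! ### Cross product and curl: triple product and regularity. -/

section Fields

/-- Behind the cancellation of the Lorentz work: `(j × B) · u = -j · (u × B)`. -/
theorem inner_cross_left (a b c : Vec 3) :
    inner ℝ (cross a b) c = -inner ℝ a (cross c b) := by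
  simp [cross, cross_apply, PiLp.inner_apply, Fin.sum_univ_three]
  ring

theorem contDiff_emb {d : ℕ} : ContDiff ℝ 1 (emb : Vec d → Vec 3) := by
  rw [contDiff_euclidean]
  intro i
  by_cases h : i.val < d
  · simp only [emb, h, dite_true]
    fun_prop
  · simp only [emb, h, dite_false]
    fun_prop

theorem contDiff_cross {E : Type*} [NormedAddCommGroup E] [NormedSpace ℝ E] {f g : E → Vec 3}
    (hf : ContDiff ℝ 1 f) (hg : ContDiff ℝ 1 g) : ContDiff ℝ 1 fun x => cross (f x) (g x) := by
  rw [contDiff_euclidean] at hf hg ⊢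
  intro i
  fin_cases i <;> simp only [cross, cross_apply] <;>
    exact ((hf _).mul (hg _)).sub ((hf _).mul (hg _))

theorem continuous_cross {X : Type*} [TopologicalSpace X] {f g : X → Vec 3}
    (hf : Continuous f) (hg : Continuous g) : Continuous fun x => cross (f x) (g x) :=
  (contDiff_cross (contDiff_fst (𝕜 := ℝ) (E := Vec 3) (F := Vec 3)) contDiff_snd).continuous.comp
    (hf.prodMk hg)

theorem continuous_partialD {d : ℕ} {f : Vec d → Vec 3} (hf : ContDiff ℝ 1 f) (k : Fin 3) :
    Continuous (partialD k f) := by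
  unfold partialD
  split_ifs
  · exact (hf.continuous_fderiv one_ne_zero).clm_apply continuous_const
  · exact continuous_const

theorem continuous_curl {d : ℕ} {f : Vec d → Vec 3} (hf : ContDiff ℝ 1 f) :
    Continuous (curl f) := by
  have h : ∀ k i : Fin 3, Continuous fun x => partialD k f x i := fun k i =>
    (EuclideanSpace.proj i).continuous.comp (continuous_partialD hf k)
  refine (PiLp.continuous_toLp 2 _).comp (continuous_pi fun i => ?_)
  fin_cases i
  · exact (h 1 2).sub (h 2 1)
  · exact (h 2 0).sub (h 0 2)
  · exact (h 0 1).sub (h 1 0)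

end Fields

/-! ### Regularity of discrete fields, and positivity of the density. -/

namespace Mesh

variable {d : ℕ} {M : Mesh d}

theorem continuous_of_mem_CR₀ {v : M.Broken (Vec d)} (hv : v ∈ M.CR₀) (K : M.Cell) :
    Continuous (v K) := by
  obtain ⟨A, hA⟩ := hv.1 K
  rw [show v K = A from funext hA]
  exact A.continuous_of_finiteDimensional

theorem continuous_divg_of_mem_CR₀ {v : M.Broken (Vec d)} (hv : v ∈ M.CR₀) (K : M.Cell) :
    Continuous (divg (v K)) := by
  obtain ⟨A, hA⟩ := hv.1 K
  rw [show v K = A from funext hA, funext (divg_affineMap A)]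
  exact continuous_const

theorem continuous_of_mem_RT₀ {v : M.Broken (Vec d)} (hv : v ∈ M.RT₀) (K : M.Cell) :
    Continuous (v K) := by
  obtain ⟨a, b, h⟩ := hv.1 K
  rw [funext h]
  fun_prop

theorem contDiff_of_mem_ND₀ {v : M.Broken (Vec 3)} (hv : v ∈ M.ND₀) (K : M.Cell) :
    ContDiff ℝ 1 (v K) := by
  obtain ⟨a, b, h⟩ := hv.1 K
  rw [funext h]
  exact contDiff_const.add (contDiff_cross contDiff_const contDiff_emb)

theorem integral_add {f g : M.Broken ℝ} (hf : ∀ K, Continuous (f K)) (hg : ∀ K, Continuous (g K)) :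
    M.integral (fun K x => f K x + g K x) = M.integral f + M.integral g := by
  simp only [integral, ← Finset.sum_add_distrib]
  refine Finset.sum_congr rfl fun K _ => MeasureTheory.integral_add ?_ ?_
  · exact (hf K).continuousOn.integrableOn_compact (isCompact_hull _)
  · exact (hg K).continuousOn.integrableOn_compact (isCompact_hull _)

theorem integral_const_mul (c : ℝ) (f : M.Broken ℝ) :
    M.integral (fun K x => c * f K x) = c * M.integral f := by
  simp only [integral, MeasureTheory.integral_const_mul, Finset.mul_sum]

theorem integral_sub {f g : M.Broken ℝ} (hf : ∀ K, Continuous (f K)) (hg : ∀ K, Continuous (g K)) :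
    M.integral (fun K x => f K x - g K x) = M.integral f - M.integral g := by
  have := M.integral_add hf (g := fun K x => -1 * g K x) fun K => (hg K).const_mul _
  rw [M.integral_const_mul] at this
  simpa [sub_eq_add_neg] using this

theorem integral_nonneg {f : M.Broken ℝ} (hf : ∀ K x, 0 ≤ f K x) : 0 ≤ M.integral f :=
  Finset.sum_nonneg fun K _ => MeasureTheory.integral_nonneg (hf K)

theorem upwind_pos {r : M.Cell → ℝ} (hr : ∀ K, 0 < r K) (u : M.Broken (Vec d)) (σ : M.IFace) :
    0 < M.upwind r u σ := by
  unfold upwind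
  split_ifs <;> exact hr _

theorem rpow_meshSize_nonneg (ε : ℝ) : 0 ≤ M.meshSize ^ ε :=
  Real.rpow_nonneg M.meshSize_nonneg ε

/-- The implicit upwind discretisation of the continuity equation preserves positivity. -/
theorem density_pos {τ ε : ℝ} (hτ : 0 < τ) {r' r : M.Cell → ℝ} (hr' : ∀ K, 0 < r' K)
    (u : M.Broken (Vec d))
    (h : ∀ φ : M.Cell → ℝ, M.integral (fun K _ => τ⁻¹ * (r K - r' K) * φ K) -
      ∑ σ, M.faceIntegral σ (fun _ => M.flux ε r u σ * M.jumpC φ σ) = 0) (K : M.Cell) :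
    0 < r K := by
  by_contra! hK
  -- With this test function the cell sum is strictly negative, since `r ≤ 0 < r'` on its support.
  -- The flux sum is nonnegative: across a face where the sign of `r` changes, both upwinding and
  -- diffusion have the right sign. This contradicts their equality.
  have h0 := h fun K => if r K ≤ 0 then 1 else 0
  rw [M.integral_const fun K => τ⁻¹ * (r K - r' K) * if r K ≤ 0 then 1 else 0] at h0
  simp only [faceIntegral_const] at h0
  have h1 : ∑ K, M.vol K * (τ⁻¹ * (r K - r' K) * if r K ≤ 0 then 1 else 0) < 0 := by
    have hneg : ∀ L, r L ≤ 0 → M.vol L * (τ⁻¹ * (r L - r' L)) < 0 := fun L hL =>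
      mul_neg_of_pos_of_neg (M.vol_pos L)
        (mul_neg_of_pos_of_neg (inv_pos.2 hτ) (by linarith [hr' L]))
    refine Finset.sum_neg' (fun L _ => ?_) ⟨K, Finset.mem_univ K, ?_⟩
    · split_ifs with hL
      · simpa using (hneg L hL).le
      · simp
    · simpa [hK] using hneg K hK
  have h2 : 0 ≤ ∑ σ, M.area σ *
      (M.flux ε r u σ * M.jumpC (fun K => if r K ≤ 0 then (1 : ℝ) else 0) σ) := by
    refine Finset.sum_nonneg fun σ _ => mul_nonneg (M.area_nonneg σ) ?_
    have hk := M.rpow_meshSize_nonneg ε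
    simp only [flux, jumpC, upwind, smul_eq_mul]
    rcases le_or_gt (r (M.inn σ).1) 0 with hi | hi <;>
    rcases le_or_gt (r (M.out σ).1) 0 with ho | ho
    · simp [hi, ho]
    · have h3 : M.meshSize ^ ε * (r (M.out σ).1 - r (M.inn σ).1) ≥ 0 :=
        mul_nonneg hk (by linarith)
      simp only [hi, ho.not_ge, if_true, if_false]
      split_ifs with hw
      · have := mul_nonpos_of_nonneg_of_nonpos hw hi
        linarith
      · have := mul_nonpos_of_nonpos_of_nonneg (not_le.1 hw).le ho.le
        linarith
    · have h3 : M.meshSize ^ ε * (r (M.out σ).1 - r (M.inn σ).1) ≤ 0 :=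
        mul_nonpos_of_nonneg_of_nonpos hk (by linarith)
      simp only [hi.not_ge, ho, if_true, if_false]
      split_ifs with hw
      · have := mul_nonneg hw hi.le
        linarith
      · have := mul_nonneg_of_nonpos_of_nonpos (not_le.1 hw).le ho
        linarith
    · simp [hi.not_ge, ho.not_ge]
  linarith

end Mesh

/-! ### Signs of the dissipation terms. -/

section Energy

variable {d : ℕ} {M : Mesh d} {P : Params} {ρ : ℝ → M.Cell → ℝ} {u B : ℝ → M.Broken (Vec d)}
  {E : ℝ → M.Broken (Vec 3)}

theorem energy_eq {t : ℝ} (hB : ∀ K, Continuous (B t K)) :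
    energy M P ρ u B t = ∑ K, M.vol K * (1 / 2 * ρ t K * ‖M.hat (u t) K‖ ^ 2) +
      ∑ K, M.vol K * P.H (ρ t K) + M.integral (fun K x => 1 / 2 * ‖B t K x‖ ^ 2) := by
  rw [energy, M.integral_add (f := fun K _ => 1 / 2 * ρ t K * ‖M.hat (u t) K‖ ^ 2 + P.H (ρ t K))
    (g := fun K x => 1 / 2 * ‖B t K x‖ ^ 2) (fun K => continuous_const)
    fun K => ((hB K).norm.pow 2).const_mul _, M.integral_const]
  simp only [mul_add, Finset.sum_add_distrib]

theorem dissipation_nonneg (hμ : 0 < P.μ) (hν : 0 ≤ P.ν d) (t : ℝ) :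
    0 ≤ dissipation M P u B E t := by
  refine add_nonneg (add_nonneg (mul_nonneg hμ.le ?_) (mul_nonneg hν ?_)) ?_
  · exact M.integral_nonneg fun K x => Finset.sum_nonneg fun i _ => Finset.sum_nonneg fun j _ =>
      mul_self_nonneg _
  · exact M.integral_nonneg fun K x => sq_nonneg _
  · exact M.integral_nonneg fun K x => sq_nonneg _

theorem numericalTerms_nonpos (ha : 0 < P.a) (hγ : 1 < P.γ) (hτ : 0 < P.τ) {t : ℝ}
    (hρ' : ∀ K, 0 < ρ (t - P.τ) K) (hρ : ∀ K, 0 < ρ t K) {ξ : M.Cell → ℝ} {ζ : M.IFace → ℝ}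
    (hξ : ∀ K, ξ K ∈ uIcc (ρ (t - P.τ) K) (ρ t K))
    (hζ : ∀ σ, ζ σ ∈ uIcc (ρ t (M.inn σ).1) (ρ t (M.out σ).1)) :
    numericalTerms M P ρ u B ξ ζ t ≤ 0 := by
  have hξ' : ∀ K, 0 < P.H'' (ξ K) := fun K =>
    Params.H''_pos ha hγ ((lt_min (hρ' K) (hρ K)).trans_le (hξ K).1)
  have hζ' : ∀ σ, 0 < P.H'' (ζ σ) := fun σ =>
    Params.H''_pos ha hγ ((lt_min (hρ _) (hρ _)).trans_le (hζ σ).1)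
  have hk := M.rpow_meshSize_nonneg P.ε
  have h1 : 0 ≤ P.τ / 2 * M.integral (fun K _ =>
      ρ (t - P.τ) K * ‖Dt P.τ (fun s => M.hat (u s)) t K‖ ^ 2) :=
    mul_nonneg (by positivity) (M.integral_nonneg fun K _ => mul_nonneg (hρ' K).le (sq_nonneg _))
  have h2 : 0 ≤ P.τ / 2 * M.integral (fun K x => ‖Dt P.τ B t K x‖ ^ 2) :=
    mul_nonneg (by positivity) (M.integral_nonneg fun K _ => sq_nonneg _)
  have h3 : 0 ≤ P.τ / 2 * M.integral (fun K _ => P.H'' (ξ K) * |Dt P.τ ρ t K| ^ 2) :=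
    mul_nonneg (by positivity) (M.integral_nonneg fun K _ => mul_nonneg (hξ' K).le (sq_nonneg _))
  have h4 : 0 ≤ ∑ σ, M.faceIntegral σ (fun _ =>
      (M.upwind (ρ t) (u t) σ * (|M.normalVel (u t) σ| / 2) +
        M.meshSize ^ P.ε * M.avgC (ρ t) σ) * ‖M.jumpC (M.hat (u t)) σ‖ ^ 2) := by
    refine Finset.sum_nonneg fun σ _ => ?_
    rw [M.faceIntegral_const]
    have h5 := M.upwind_pos hρ (u t) σ
    have h6 : 0 < M.avgC (ρ t) σ := half_pos (add_pos (hρ _) (hρ _))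
    have h7 := M.area_nonneg σ
    positivity
  have h5 : 0 ≤ ∑ σ, M.faceIntegral σ (fun _ =>
      P.H'' (ζ σ) * M.jumpC (ρ t) σ ^ 2 *
        (M.meshSize ^ P.ε + |M.normalVel (u t) σ| / 2)) := by
    refine Finset.sum_nonneg fun σ _ => ?_
    rw [M.faceIntegral_const]
    have h6 := hζ' σ
    have h7 := M.area_nonneg σ
    positivity
  unfold numericalTerms
  linarith

end Energy

/-! ### The tested equations and their sum. -/

section Balance

variable {d : ℕ} {M : Mesh d} {P : Params} {N : ℕ} {ρ : ℝ → M.Cell → ℝ}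
  {u B : ℝ → M.Broken (Vec d)} {E : ℝ → M.Broken (Vec 3)}

theorem IsSolution.density_pos (hsol : IsSolution M P N ρ u B E) (hτ : 0 < P.τ)
    (hρ₀ : ∀ K, 0 < ρ 0 K) {t : ℝ} (ht : t ≤ N * P.τ) (K : M.Cell) : 0 < ρ t K := by
  -- Claimed for all `t ≤ k τ` and not only on the grid, so that `t - τ` falls under the induction
  -- hypothesis.
  have key : ∀ k : ℕ, k ≤ N → ∀ t ≤ k * P.τ, ∀ K, 0 < ρ t K := fun k => by
    induction k with
    | zero =>
      intro _ t ht
      rw [hsol.ρ_step.1 t (by simpa using ht)]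
      exact hρ₀
    | succ k ih =>
      intro hk t ht
      rcases le_or_gt t 0 with h0 | h0
      · rw [hsol.ρ_step.1 t h0]
        exact hρ₀
      · have hk' : ((k + 1 : ℕ) : ℝ) ≤ N := by exact_mod_cast hk
        push_cast at ht hk'
        refine M.density_pos hτ (ih (by omega) (t - P.τ) (by linarith)) (u t)
          (hsol.continuity t ⟨h0, ht.trans (mul_le_mul_of_nonneg_right hk' hτ.le)⟩)
  exact key N le_rfl t ht K

/-- Faraday's law tested with `B` plus Ampère's law tested with `E`; substituting `E = j - u × B (t
- τ)` turns `j · E` into `|j|²` plus the work of the Lorentz force. -/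
theorem IsSolution.magnetic_balance (hsol : IsSolution M P N ρ u B E) (hτ : 0 < P.τ) {t : ℝ}
    (ht : t ∈ Ioc 0 (N * P.τ)) :
    P.τ⁻¹ * (M.integral (fun K x => 1 / 2 * ‖B t K x‖ ^ 2) -
        M.integral (fun K x => 1 / 2 * ‖B (t - P.τ) K x‖ ^ 2)) +
      P.τ / 2 * M.integral (fun K x => ‖Dt P.τ B t K x‖ ^ 2) +
      M.integral (fun K x => ‖current P u B E t K x‖ ^ 2) +
      M.integral (fun K x =>
        inner ℝ (cross (current P u B E t K x) (emb (B (t - P.τ) K x))) (emb (u t K x))) = 0 := by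
  have ht' : t - P.τ ≤ N * P.τ := by linarith [ht.2]
  have hu := M.continuous_of_mem_CR₀ (hsol.u_step.2.2 t ht.2)
  have hBt := hsol.B_step.2.2 t ht.2
  have hB := M.continuous_of_mem_RT₀ hBt
  have hB' := M.continuous_of_mem_RT₀ (hsol.B_step.2.2 _ ht')
  have hEt := hsol.E_step.2.2 t ht.2
  have hE := fun K => (M.contDiff_of_mem_ND₀ hEt K).continuous
  have hcE := fun K => continuous_curl (M.contDiff_of_mem_ND₀ hEt K)
  have hemb := (contDiff_emb (d := d)).continuous
  have hj : ∀ K, Continuous (current P u B E t K) := fun K =>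
    (hE K).add (continuous_cross (hemb.comp (hu K)) (hemb.comp (hB' K)))
  have hDB : ∀ K, Continuous (Dt P.τ B t K) := fun K => ((hB K).sub (hB' K)).const_smul P.τ⁻¹
  have hL : ∀ K, Continuous fun x =>
      inner ℝ (cross (current P u B E t K x) (emb (B (t - P.τ) K x))) (emb (u t K x)) := fun K =>
    (continuous_cross (hj K) (hemb.comp (hB' K))).inner (hemb.comp (hu K))
  have h1 := hsol.faraday t ht _ hBt
  have h2 := hsol.ampere t ht _ hEt
  -- The identity already holds pointwise. The continuity statements below serve only to split its
  -- integral.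
  have h3 : ∀ K x, P.τ⁻¹ * (1 / 2 * ‖B t K x‖ ^ 2) - P.τ⁻¹ * (1 / 2 * ‖B (t - P.τ) K x‖ ^ 2) +
      P.τ / 2 * ‖Dt P.τ B t K x‖ ^ 2 + ‖current P u B E t K x‖ ^ 2 +
      inner ℝ (cross (current P u B E t K x) (emb (B (t - P.τ) K x))) (emb (u t K x)) =
      (inner ℝ (Dt P.τ B t K x) (B t K x) + inner ℝ (curl (E t K) x) (emb (B t K x))) +
      (inner ℝ (current P u B E t K x) (E t K x) -
        inner ℝ (emb (B t K x)) (curl (E t K) x)) := fun K x => by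
    have h4 := magnetic_identity hτ (B (t - P.τ) K x) (B t K x)
    have h5 : inner ℝ (current P u B E t K x) (E t K x) = ‖current P u B E t K x‖ ^ 2 -
        inner ℝ (current P u B E t K x) (cross (emb (u t K x)) (emb (B (t - P.τ) K x))) := by
      rw [← real_inner_self_eq_norm_sq, ← inner_sub_right]
      congr 1
      simp [current]
    rw [h5, inner_cross_left, real_inner_comm (curl (E t K) x)]
    change inner ℝ (Dt P.τ B t K x) (B t K x) = _ + P.τ / 2 * ‖Dt P.τ B t K x‖ ^ 2 at h4
    rw [h4]
    ring
  have h4 := congrArg M.integral (funext fun K => funext fun x => h3 K x)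
  have c1 : ∀ K, Continuous fun x => 1 / 2 * ‖B t K x‖ ^ 2 := fun K => by
    have := hB K
    fun_prop
  have c2 : ∀ K, Continuous fun x => 1 / 2 * ‖B (t - P.τ) K x‖ ^ 2 := fun K => by
    have := hB' K
    fun_prop
  have c3 : ∀ K, Continuous fun x => ‖Dt P.τ B t K x‖ ^ 2 := fun K => (hDB K).norm.pow 2
  have c4 : ∀ K, Continuous fun x => ‖current P u B E t K x‖ ^ 2 := fun K => (hj K).norm.pow 2
  have c5 : ∀ K, Continuous fun x => inner ℝ (Dt P.τ B t K x) (B t K x) +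
      inner ℝ (curl (E t K) x) (emb (B t K x)) := fun K =>
    ((hDB K).inner (hB K)).add ((hcE K).inner (hemb.comp (hB K)))
  have c6 : ∀ K, Continuous fun x => inner ℝ (current P u B E t K x) (E t K x) -
      inner ℝ (emb (B t K x)) (curl (E t K) x) := fun K =>
    ((hj K).inner (hE K)).sub ((hemb.comp (hB K)).inner (hcE K))
  have c7 : ∀ K, Continuous fun x => P.τ⁻¹ * (1 / 2 * ‖B t K x‖ ^ 2) -
      P.τ⁻¹ * (1 / 2 * ‖B (t - P.τ) K x‖ ^ 2) := fun K =>
    ((c1 K).const_mul _).sub ((c2 K).const_mul _)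
  have c8 : ∀ K, Continuous fun x => P.τ⁻¹ * (1 / 2 * ‖B t K x‖ ^ 2) -
      P.τ⁻¹ * (1 / 2 * ‖B (t - P.τ) K x‖ ^ 2) + P.τ / 2 * ‖Dt P.τ B t K x‖ ^ 2 := fun K =>
    (c7 K).add ((c3 K).const_mul _)
  have c9 : ∀ K, Continuous fun x => P.τ⁻¹ * (1 / 2 * ‖B t K x‖ ^ 2) -
      P.τ⁻¹ * (1 / 2 * ‖B (t - P.τ) K x‖ ^ 2) + P.τ / 2 * ‖Dt P.τ B t K x‖ ^ 2 +
      ‖current P u B E t K x‖ ^ 2 := fun K => (c8 K).add (c4 K)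
  rw [M.integral_add c5 c6, h1, h2, M.integral_add c9 hL, M.integral_add c8 c4,
    M.integral_add c7 (fun K => (c3 K).const_mul _),
    M.integral_sub (fun K => (c1 K).const_mul _) (fun K => (c2 K).const_mul _),
    M.integral_const_mul (P.τ / 2) (fun K x => ‖Dt P.τ B t K x‖ ^ 2),
    M.integral_const_mul P.τ⁻¹ (fun K x => 1 / 2 * ‖B t K x‖ ^ 2),
    M.integral_const_mul P.τ⁻¹ (fun K x => 1 / 2 * ‖B (t - P.τ) K x‖ ^ 2)] at h4
  linarith

/-- The momentum equation tested with `u`, with the pressure moved to the faces, where it can meet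
the mass flux. -/
theorem IsSolution.momentum_balance (hsol : IsSolution M P N ρ u B E) (hd : d ≠ 0) {t : ℝ}
    (ht : t ∈ Ioc 0 (N * P.τ)) :
    ∑ K, M.vol K * inner ℝ (Dt P.τ (fun s K => ρ s K • M.hat (u s) K) t K) (M.hat (u t) K) -
      ∑ σ, M.area σ *
        inner ℝ (M.flux P.ε (fun K => ρ t K • M.hat (u t) K) (u t) σ) (M.jumpC (M.hat (u t)) σ) +
      P.μ * M.integral (fun K x => gradInner (u t K) (u t K) x) +
      (P.ν d * M.integral (fun K x => divg (u t K) x ^ 2) +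
        ∑ σ, M.area σ * (M.normalVel (u t) σ * M.jumpC (fun K => P.p (ρ t K)) σ)) -
      M.integral (fun K x =>
        inner ℝ (cross (current P u B E t K x) (emb (B (t - P.τ) K x))) (emb (u t K x))) = 0 := by
  have hut := hsol.u_step.2.2 t ht.2
  have h := hsol.momentum t ht _ hut
  have hdiv := M.continuous_divg_of_mem_CR₀ hut
  have h1 : M.integral (fun K x => (P.ν d * divg (u t K) x - P.p (ρ t K)) * divg (u t K) x) =
      P.ν d * M.integral (fun K x => divg (u t K) x ^ 2) +
        ∑ σ, M.area σ * (M.normalVel (u t) σ * M.jumpC (fun K => P.p (ρ t K)) σ) := by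
    rw [← neg_neg (∑ σ, _), ← M.integral_mul_divg hd hut, ← sub_eq_add_neg,
      ← M.integral_const_mul,
      ← M.integral_sub (f := fun K x => P.ν d * divg (u t K) x ^ 2)
        (fun K => ((hdiv K).pow 2).const_mul _) (fun K => (hdiv K).const_mul _)]
    congr 1
    ext K x
    ring
  have h2 : M.integral (fun K x =>
      inner ℝ (Dt P.τ (fun s K => ρ s K • M.hat (u s) K) t K) (u t K x)) =
      ∑ K, M.vol K *
        inner ℝ (Dt P.τ (fun s K => ρ s K • M.hat (u s) K) t K) (M.hat (u t) K) :=
    Finset.sum_congr rfl fun K _ => M.setIntegral_hull_inner (M.continuous_of_mem_CR₀ hut K) _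
  simp only [Mesh.faceIntegral_const] at h
  rwa [h1, h2] at h

theorem IsSolution.continuity_balance (hsol : IsSolution M P N ρ u B E) {t : ℝ}
    (ht : t ∈ Ioc 0 (N * P.τ)) (φ : M.Cell → ℝ) :
    ∑ K, M.vol K * (P.τ⁻¹ * (ρ t K - ρ (t - P.τ) K) * φ K) -
      ∑ σ, M.area σ * (M.flux P.ε (ρ t) (u t) σ * M.jumpC φ σ) = 0 := by
  have h := hsol.continuity t ht φ
  rw [M.integral_const fun K => Dt P.τ ρ t K * φ K] at h
  simp only [Mesh.faceIntegral_const] at h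
  exact h

/-- The energy balance of the scheme at a time `t`. -/
theorem IsSolution.energy_balance (hsol : IsSolution M P N ρ u B E) (hd : d ≠ 0) (hγ : 1 < P.γ)
    (hτ : 0 < P.τ) (hρ₀ : ∀ K, 0 < ρ 0 K) {t : ℝ} (ht : t ∈ Ioc 0 (N * P.τ)) :
    ∃ (ξ : M.Cell → ℝ) (ζ : M.IFace → ℝ),
      (∀ K, ξ K ∈ uIcc (ρ (t - P.τ) K) (ρ t K)) ∧
      (∀ σ, ζ σ ∈ uIcc (ρ t (M.inn σ).1) (ρ t (M.out σ).1)) ∧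
      Dt P.τ (energy M P ρ u B) t + dissipation M P u B E t =
        numericalTerms M P ρ u B ξ ζ t := by
  have ht' : t - P.τ ≤ N * P.τ := by linarith [ht.2]
  have hρ := hsol.density_pos hτ hρ₀ ht.2
  have hρ' := hsol.density_pos hτ hρ₀ ht'
  have hB := M.continuous_of_mem_RT₀ (hsol.B_step.2.2 t ht.2)
  have hB' := M.continuous_of_mem_RT₀ (hsol.B_step.2.2 _ ht')
  choose ξ hξ hξeq using fun K => Params.exists_taylor_H hγ (hρ' K) (hρ K)
  choose ζ hζ hζeq using fun σ => Params.exists_face_dissipation hγ (w := M.normalVel (u t) σ)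
    (hρ (M.inn σ).1) (hρ (M.out σ).1) (M.rpow_meshSize_nonneg P.ε)
  refine ⟨ξ, ζ, hξ, hζ, ?_⟩
  have hmag := hsol.magnetic_balance hτ ht
  have hmom := hsol.momentum_balance hd ht
  have hkin := hsol.continuity_balance ht fun K => 1 / 2 * ‖M.hat (u t) K‖ ^ 2
  have hint := hsol.continuity_balance ht fun K => P.dH (ρ t K)
  have hcell : ∑ K, M.vol K *
        inner ℝ (Dt P.τ (fun s K => ρ s K • M.hat (u s) K) t K) (M.hat (u t) K) -
      ∑ K, M.vol K * (P.τ⁻¹ * (ρ t K - ρ (t - P.τ) K) * (1 / 2 * ‖M.hat (u t) K‖ ^ 2)) =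
      P.τ⁻¹ * (∑ K, M.vol K * (1 / 2 * ρ t K * ‖M.hat (u t) K‖ ^ 2) -
        ∑ K, M.vol K * (1 / 2 * ρ (t - P.τ) K * ‖M.hat (u (t - P.τ)) K‖ ^ 2)) +
      P.τ / 2 * ∑ K, M.vol K *
        (ρ (t - P.τ) K * ‖Dt P.τ (fun s => M.hat (u s)) t K‖ ^ 2) := by
    simp only [Finset.mul_sum, ← Finset.sum_sub_distrib, ← Finset.sum_add_distrib]
    refine Finset.sum_congr rfl fun K _ => ?_
    have := kinetic_cell_identity hτ (M.hat (u (t - P.τ)) K) (M.hat (u t) K)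
      (ρ (t - P.τ) K) (ρ t K)
    simp only [Dt, Pi.smul_apply, Pi.sub_apply]
    linear_combination M.vol K * this
  have hpot : ∑ K, M.vol K * (P.τ⁻¹ * (ρ t K - ρ (t - P.τ) K) * P.dH (ρ t K)) =
      P.τ⁻¹ * (∑ K, M.vol K * P.H (ρ t K) - ∑ K, M.vol K * P.H (ρ (t - P.τ) K)) +
      P.τ / 2 * ∑ K, M.vol K * (P.H'' (ξ K) * |Dt P.τ ρ t K| ^ 2) := by
    simp only [Finset.mul_sum, ← Finset.sum_sub_distrib, ← Finset.sum_add_distrib]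
    refine Finset.sum_congr rfl fun K _ => ?_
    simp only [Dt, Pi.smul_apply, Pi.sub_apply, sq_abs, smul_eq_mul]
    have h1 : P.τ * P.τ⁻¹ = 1 := mul_inv_cancel₀ hτ.ne'
    linear_combination M.vol K * P.τ⁻¹ * hξeq K -
      1 / 2 * M.vol K * P.H'' (ξ K) * (ρ t K - ρ (t - P.τ) K) ^ 2 * P.τ⁻¹ * h1
  have hface₁ : -∑ σ, M.area σ *
        inner ℝ (M.flux P.ε (fun K => ρ t K • M.hat (u t) K) (u t) σ) (M.jumpC (M.hat (u t)) σ) +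
      ∑ σ, M.area σ * (M.flux P.ε (ρ t) (u t) σ *
        M.jumpC (fun K => 1 / 2 * ‖M.hat (u t) K‖ ^ 2) σ) =
      ∑ σ, M.area σ * ((M.upwind (ρ t) (u t) σ * (|M.normalVel (u t) σ| / 2) +
        M.meshSize ^ P.ε * M.avgC (ρ t) σ) * ‖M.jumpC (M.hat (u t)) σ‖ ^ 2) := by
    rw [← Finset.sum_neg_distrib, ← Finset.sum_add_distrib]
    refine Finset.sum_congr rfl fun σ _ => ?_
    have := kinetic_face_identity (M.hat (u t) (M.inn σ).1) (M.hat (u t) (M.out σ).1)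
      (ρ t (M.inn σ).1) (ρ t (M.out σ).1) (M.normalVel (u t) σ) (M.meshSize ^ P.ε)
    simp only [Mesh.flux, Mesh.upwind, Mesh.jumpC, Mesh.avgC, smul_eq_mul]
    linear_combination M.area σ * this
  have hface₂ : -∑ σ, M.area σ * (M.flux P.ε (ρ t) (u t) σ *
        M.jumpC (fun K => P.dH (ρ t K)) σ) +
      ∑ σ, M.area σ * (M.normalVel (u t) σ * M.jumpC (fun K => P.p (ρ t K)) σ) =
      ∑ σ, M.area σ * (P.H'' (ζ σ) * M.jumpC (ρ t) σ ^ 2 *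
        (M.meshSize ^ P.ε + |M.normalVel (u t) σ| / 2)) := by
    rw [← Finset.sum_neg_distrib, ← Finset.sum_add_distrib]
    refine Finset.sum_congr rfl fun σ _ => ?_
    simp only [Mesh.flux, Mesh.upwind, Mesh.jumpC, smul_eq_mul]
    linear_combination M.area σ * hζeq σ
  have hDt : Dt P.τ (energy M P ρ u B) t =
      P.τ⁻¹ * (energy M P ρ u B t - energy M P ρ u B (t - P.τ)) := rfl
  rw [hDt, energy_eq hB, energy_eq hB', dissipation, numericalTerms,
    M.integral_const fun K => ρ (t - P.τ) K * ‖Dt P.τ (fun s => M.hat (u s)) t K‖ ^ 2,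
    M.integral_const fun K => P.H'' (ξ K) * |Dt P.τ ρ t K| ^ 2]
  simp only [Mesh.faceIntegral_const]
  -- The first four terms are the tested equations. The last four replace cell and face
  -- contributions by energy differences and numerical dissipation.
  linear_combination hmag + hmom - hkin + hint - hcell - hpot - hface₁ - hface₂

end Balance

end MHD

/-! ### The stability theorem. -/

theorem mainTheorem3 (d : ℕ) (hd : d = 2 ∨ d = 3) (M : MHD.Mesh d)
    (hM : (∃ Ω, M.Triangulates Ω) ∨ M.TriangulatesTorus)
    (P : MHD.Params) (hμ : 0 < P.μ) (hν : 0 ≤ P.ν d) (ha : 0 < P.a) (hγ : 1 < P.γ)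
    (hε : -1 < P.ε) (hτ : 0 < P.τ) (N : ℕ)
    (ρ : ℝ → M.Cell → ℝ) (u B : ℝ → M.Broken (MHD.Vec d)) (E : ℝ → M.Broken (MHD.Vec 3))
    (hsol : MHD.IsSolution M P N ρ u B E) (hρ₀ : ∀ K, 0 < ρ 0 K) :
    (∀ t ∈ Set.Ioc 0 (N * P.τ),
      (∀ K, 0 < ρ t K) ∧
      ∃ (ξ : M.Cell → ℝ) (ζ : M.IFace → ℝ),
        (∀ K, ξ K ∈ Set.uIcc (ρ (t - P.τ) K) (ρ t K)) ∧
        (∀ σ, ζ σ ∈ Set.uIcc (ρ t (M.inn σ).1) (ρ t (M.out σ).1)) ∧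
        MHD.Dt P.τ (MHD.energy M P ρ u B) t + MHD.dissipation M P u B E t =
          MHD.numericalTerms M P ρ u B ξ ζ t ∧
        MHD.numericalTerms M P ρ u B ξ ζ t ≤ 0) ∧
    AntitoneOn (MHD.energy M P ρ u B) (Set.Icc 0 (N * P.τ)) := by
  have hd0 : d ≠ 0 := by omega
  have main : ∀ t ∈ Set.Ioc 0 (N * P.τ),
      (∀ K, 0 < ρ t K) ∧
      ∃ (ξ : M.Cell → ℝ) (ζ : M.IFace → ℝ),
        (∀ K, ξ K ∈ Set.uIcc (ρ (t - P.τ) K) (ρ t K)) ∧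
        (∀ σ, ζ σ ∈ Set.uIcc (ρ t (M.inn σ).1) (ρ t (M.out σ).1)) ∧
        MHD.Dt P.τ (MHD.energy M P ρ u B) t + MHD.dissipation M P u B E t =
          MHD.numericalTerms M P ρ u B ξ ζ t ∧
        MHD.numericalTerms M P ρ u B ξ ζ t ≤ 0 := by
    intro t ht
    have hρ := hsol.density_pos hτ hρ₀ ht.2
    have hρ' := hsol.density_pos hτ hρ₀ (t := t - P.τ) (by linarith [ht.2])
    obtain ⟨ξ, ζ, hξ, hζ, h⟩ := hsol.energy_balance hd0 hγ hτ hρ₀ ht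
    exact ⟨hρ, ξ, ζ, hξ, hζ, h, MHD.numericalTerms_nonpos ha hγ hτ hρ' hρ hξ hζ⟩
  refine ⟨main, MHD.antitoneOn_of_step hτ ?_ ?_⟩
  · intro k hk hkN t ht
    simp only [MHD.energy, hsol.ρ_step.2.1 k hk hkN t ht, hsol.u_step.2.1 k hk hkN t ht,
      hsol.B_step.2.1 k hk hkN t ht]
  · intro t ht
    obtain ⟨-, ξ, ζ, -, -, h, hle⟩ := main t ht
    have hdis := MHD.dissipation_nonneg (M := M) (u := u) (B := B) (E := E) hμ hν t
    have h1 : P.τ⁻¹ * (MHD.energy M P ρ u B t - MHD.energy M P ρ u B (t - P.τ)) ≤ 0 := by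
      change MHD.Dt P.τ (MHD.energy M P ρ u B) t ≤ 0
      linarith
    exact sub_nonpos.1 (nonpos_of_mul_nonpos_right h1 (inv_pos.2 hτ))
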